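/- **Setting.** Let $d,n,m\ge 1$ be integers and let $(x_i,y_i)\in\mathbb R^d\times\mathbb R$, $i=1,\dots,n$, be data points with $\|x_i\|=\sqrt d$ and $|y_i|\le C_y$, where $C_y\ge 1$, such that no two of $x_1,\dots,x_n$ are parallel (for $i\ne j$, $x_i$ and $x_j$ are linearly independent). Write $\tilde x=(x,1)\in\mathbb R^{d+1}$, $\sigma(z)=\max(z,0)$ and $\sigma'(z)=\mathbf 1_{z\ge 0}$. For $a\in\{1,-1\}^m$ and $w=(w_1,\dots,w_m)\in\mathbb R^{m(d+1)}$ consider the network $$f(x,w)=\sum_{r=1}^m\frac{a_r}{\sqrt m}\,\sigma(w_r^{\top}\tilde x),\qquad \nabla f(x,w)=\Big(\frac{a_r}{\sqrt m}\,\sigma'(w_r^{\top}\tilde x)\,\tilde x\Big)_{r=1}^m\in\mathbb R^{m(d+1)} .$$ At initialization $a_1,\dots,a_m$ are uniform on $\{1,-1\}$, $w_1(0),\dots,w_m(0)$ are standard Gaussian vectors in $\mathbb R^{d+1}$ (that is, $\kappa=1$), and all of them are independent. The $a_r$ are then kept fixed, and the weights are trained by gradient descent with step size $\eta>0$: $$w(k+1)=w(k)-\eta\sum_{i=1}^n\big(f(x_i,w(k))-y_i\big)\nabla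 f(x_i,w(k)),\qquad k=0,1,2,\dots$$ Let $f_L(x,w)=f(x,w(0))+\nabla f(x,w(0))^{\top}(w-w(0))$ be the linearization of the network at $w(0)$, let $$w_L^*=\arg\min_w\|w-w(0)\|\quad\text{subject to } f_L(x_i,w)=y_i,\ i=1,\dots,n,$$ and let $H\in\mathbb R^{n\times n}$, $H_{ij}=\mathbb E\big[\nabla f(x_i,w(0))^{\top}\nabla f(x_j,w(0))\big]$, the expectation being over the initialization. Norms of vectors are Euclidean. **Theorem.** There are absolute constants $K_1,K_2,K_3>0$ such that the following holds for all $d$, $n$, $m$, $C_y$ and all data as above. The matrix $H$ is positive definite. Moreover, let $c>0$ be such that $H\succeq cI$, let $0<\delta<1$, and suppose that $$m\ \ge\ K_1\,\frac{(dn)^{10}C_y^6}{c^{10}\delta^6},\qquad 0<\eta\le K_2\,\frac{c}{(dn)^2}.$$ Then with probability greater than $1-\delta$ over the initialization, $w_L^*$ exists and is unique, for all $k=0,1,2,\dots$ $$\|w(k)-w_L^*\|\ \le\ \Big(1-\frac{c\eta}{2}\Big)^{k/2}\|w(0)-w_L^*\|+K_3\,\frac{(dnC_y)^{1.5}}{c^{1.5}\delta^{1.5}m^{1/8}},$$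 and $w(k)$ converges to some point $w^*$ as $k\to\infty$. -/

import Mathlib

open MeasureTheory ProbabilityTheory Filter Topology
open scoped ENNReal

noncomputable section

namespace ReLUNet

/-- The space of inputs of dimension `d`, with the Euclidean norm. -/
abbrev Input (d : ℕ) : Type := EuclideanSpace ℝ (Fin d)

/-- The weight vector of a single neuron (the bias is the last coordinate). -/
abbrev Neuron (d : ℕ) : Type := EuclideanSpace ℝ (Fin (d + 1))

/-- The weights `w = (w_1, …, w_m)` of the whole network, a vector in `ℝ^{m(d+1)}` with its
Euclidean norm. -/
abbrev Weights (d m : ℕ) : Type := PiLp 2 (fun _ : Fin m => Neuron d)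

/-- The augmented input `x̃ = (x, 1)`. -/
def aug {d : ℕ} (x : Input d) : Neuron d :=
  WithLp.toLp 2 (Fin.snoc (α := fun _ => ℝ) (fun i => x i) 1)

/-- The ReLU activation `σ(z) = max(z, 0)`. -/
def relu (z : ℝ) : ℝ := max z 0

/-- The derivative of the ReLU, with the convention `σ'(0) = 1`. -/
def reluDeriv (z : ℝ) : ℝ := if 0 ≤ z then 1 else 0

/-- The network `f(x, w) = ∑_r (a_r / √m) σ(w_rᵀ x̃)`. -/
def net {d m : ℕ} (a : Fin m → ℝ) (x : Input d) (w : Weights d m) : ℝ :=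
  ∑ r, a r / √(m : ℝ) * relu (inner ℝ (w r) (aug x))

/-- The gradient `∇f(x, w)` with respect to the weights: its `r`-th block is
`(a_r / √m) σ'(w_rᵀ x̃) x̃`. -/
def gradNet {d m : ℕ} (a : Fin m → ℝ) (x : Input d) (w : Weights d m) : Weights d m :=
  WithLp.toLp 2 fun r => (a r / √(m : ℝ) * reluDeriv (inner ℝ (w r) (aug x))) • aug x

/-- The first-order Taylor approximation `f_L(x, w)` of the network around `w0`. -/
def linNet {d m : ℕ} (a : Fin m → ℝ) (w0 : Weights d m) (x : Input d) (w : Weights d m) : ℝ :=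
  net a x w0 + inner ℝ (gradNet a x w0) (w - w0)

/-- `wL` minimises `‖w - w0‖` among all `w` with `f_L(x_i, w) = y_i` for all `i`. -/
def IsMinNormInterpolator {d m n : ℕ} (a : Fin m → ℝ) (w0 : Weights d m)
    (x : Fin n → Input d) (y : Fin n → ℝ) (wL : Weights d m) : Prop :=
  (∀ i, linNet a w0 (x i) wL = y i) ∧
    ∀ w : Weights d m, (∀ i, linNet a w0 (x i) w = y i) → ‖wL - w0‖ ≤ ‖w - w0‖

/-- Gradient descent with step size `η` started at `w0`:
`w(k+1) = w(k) - η ∑_i (f(x_i, w(k)) - y_i) ∇f(x_i, w(k))`. -/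
def gd {d m n : ℕ} (a : Fin m → ℝ) (x : Fin n → Input d) (y : Fin n → ℝ) (η : ℝ)
    (w0 : Weights d m) : ℕ → Weights d m
  | 0 => w0
  | k + 1 => gd a x y η w0 k -
      η • ∑ i, (net a (x i) (gd a x y η w0 k) - y i) • gradNet a (x i) (gd a x y η w0 k)

/-- The uniform distribution on `{1, -1}`. -/
def signLaw : Measure ℝ :=
  (2⁻¹ : ℝ≥0∞) • Measure.dirac (1 : ℝ) + (2⁻¹ : ℝ≥0∞) • Measure.dirac (-1 : ℝ)

instance isProbabilityMeasure_signLaw : IsProbabilityMeasure signLaw :=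
  ⟨by simp [signLaw, ENNReal.inv_two_add_inv_two]⟩

/-- A realisation `(a, w(0))` of the initialization, the hidden weights given neuron by neuron. -/
abbrev Init (d m : ℕ) : Type := (Fin m → ℝ) × (Fin m → Neuron d)

/-- The hidden weights `w(0)` of an initialization, as one vector. -/
def Init.w0 {d m : ℕ} (p : Init d m) : Weights d m := WithLp.toLp 2 p.2

/-- The law of the initialization: all `a_r` are uniform on `{1, -1}`, all `w_r(0)` are standard
Gaussian in `ℝ^{d+1}`, and all of them are independent. -/
def initLaw (d m : ℕ) : Measure (Init d m) :=
  (Measure.pi fun _ : Fin m => signLaw).prod (Measure.pi fun _ : Fin m => stdGaussian (Neuron d))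

/-- The matrix `H = 𝔼[∇ᵀf_0 ∇f_0]`, the expectation over the initialization of the Gram matrix of
the gradients at `w(0)`. -/
def kernelMatrix {d n : ℕ} (m : ℕ) (x : Fin n → Input d) : Matrix (Fin n) (Fin n) ℝ :=
  Matrix.of fun i j =>
    ∫ p : Init d m, inner ℝ (gradNet p.1 (x i) p.w0) (gradNet p.1 (x j) p.w0) ∂initLaw d m

end ReLUNet

end

/-!
# Gradient descent on a wide ReLU network stays close to its linearization

The proof is a "lazy training" argument. Write `A₀` for the transposed Jacobian of the network on
the data at initialization, and `N = d n`.

*The initialization.* Three things hold with probability greater than `1 - δ`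
(`exists_good_init`, by Markov's inequality): the Gram matrix `A₀ᵀ A₀` is within `c / 8` of its
expectation in Frobenius norm, as its entries are means of `m` independent bounded variables; the
initial residual is at most a bound `U` with `U ^ 2` of order `N Cy ^ 2 / δ`, since the random signs
make the outputs sums of orthogonal terms; and few neurons have their hyperplane within distance `R`
of their weights, as the density of a Gaussian is bounded.

*The trajectory.* On these events everything is deterministic (`gd_of_good_init`). Let
`ρ = 1 - c η / 2`. A neuron moves by at most `R` in total as long as the residuals decay like
`ρ ^ k`, for each block of the gradient carries a factor `1 / √m`. While all neurons are within `R`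
of their start, the activation patterns, and also the slopes of the secants of the ReLU, agree with
the initial ones except at the few near neurons, so the Jacobian and its secant version are within a
small `ε` of the initial one. With secant slopes `A'` the residual evolves exactly as
`u (k + 1) = u k - η A'ᵀ A u k`, which contracts by the factor `ρ`
(`norm_sub_smul_perturbed_le`). The two estimates support each other in an induction over `k`.
Convergence follows because the steps decay geometrically.

*Comparison with the linearized solution.* Removing from `w k - wL` the accumulated
displacements caused by the change of the Jacobian leaves a vector in the range of `A₀`. There the
linearized step contracts, and the remaining error of each step is of order `η N ε U / c`
(`norm_sub_le_of_inexact_descent`). What is left is arithmetic with the constants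
(`width_bounds`).

*Positive definiteness.* The quadratic form of the kernel matrix at `u` is the mean of the square
norm of `∑ i, u i σ'(v · x̃ i) x̃ i`. As the `x i` are distinct and have the same norm, for each
`i` there is an open nonempty set of `v` that activate `x i` only, where this is `u i x̃ i`
(`posDef_kernelMatrix`).
-/

noncomputable section

namespace ReLUNet

/-! ### Gradient steps in Hilbert space -/

/-- If the increments of a sequence are at most `B ρᵏ`, then its distance to the start is at most
`B / (1 - ρ)`. -/
lemma norm_sub_zero_le_of_geometric {Z : Type*} [SeminormedAddCommGroup Z] {s : ℕ → Z}
    {ρ B : ℝ} (hρ0 : 0 ≤ ρ) (hρ : ρ < 1) (hB : 0 ≤ B)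
    (h : ∀ k, ‖s (k + 1) - s k‖ ≤ B * ρ ^ k) (k : ℕ) : ‖s k - s 0‖ ≤ B / (1 - ρ) := by
  have h1 : ‖s k - s 0‖ ≤ B / (1 - ρ) * (1 - ρ ^ k) := by
    have hne : 1 - ρ ≠ 0 := by linarith
    induction k with
    | zero => simp
    | succ k ih =>
      have : s (k + 1) - s 0 = (s (k + 1) - s k) + (s k - s 0) := by abel
      rw [this]
      refine (norm_add_le _ _).trans ((add_le_add (h k) ih).trans (le_of_eq ?_))
      field_simp
      ring
  have h2 : 0 ≤ B / (1 - ρ) * ρ ^ k :=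
    mul_nonneg (div_nonneg hB (by linarith)) (pow_nonneg hρ0 k)
  linarith

/-- With geometrically decaying residuals and bounded Jacobians, gradient descent converges. -/
lemma exists_tendsto_of_geometric_residual {X Y : Type*} [NormedAddCommGroup X]
    [NormedSpace ℝ X] [NormedAddCommGroup Y] [NormedSpace ℝ Y] [CompleteSpace Y]
    {A : ℕ → X →L[ℝ] Y} {w : ℕ → Y} {u : ℕ → X}
    {η l ρ U : ℝ} (hη : 0 ≤ η) (hA : ∀ k, ‖A k‖ ≤ l) (hρ : ρ < 1)
    (hw : ∀ k, w (k + 1) = w k - η • A k (u k)) (hu : ∀ k, ‖u k‖ ≤ ρ ^ k * U) :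
    ∃ wStar, Tendsto w atTop (𝓝 wStar) := by
  have hl : 0 ≤ l := (norm_nonneg _).trans (hA 0)
  refine cauchySeq_tendsto_of_complete (cauchySeq_of_le_geometric ρ (η * (l * U)) hρ fun k => ?_)
  rw [dist_comm, dist_eq_norm, hw, sub_sub_cancel_left, norm_neg, norm_smul,
    Real.norm_of_nonneg hη]
  calc η * ‖A k (u k)‖ ≤ η * (l * (ρ ^ k * U)) := by
        gcongr
        exact ((A k).le_opNorm _).trans (mul_le_mul (hA k) (hu k) (norm_nonneg _) hl)
    _ = _ := by ring

section Hilbert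

variable {X Y : Type*} [NormedAddCommGroup X] [InnerProductSpace ℝ X] [CompleteSpace X]
  [NormedAddCommGroup Y] [InnerProductSpace ℝ Y] [CompleteSpace Y]

/-- A gradient step for `x ↦ ‖B x‖² / 2` contracts every vector on which `B` is bounded below,
provided the step size is small against `‖B‖²`. It is applied both to the transposed Jacobian
(residuals) and to the Jacobian (weights in the range of the transpose). -/
lemma norm_sub_smul_adjoint_apply_le (B : X →L[ℝ] Y) {η l c : ℝ} (hη : 0 ≤ η) (hB : ‖B‖ ≤ l)
    (hηl : η * l ^ 2 ≤ 1 / 4) (hηc : η * c ≤ 1) (x : X) (hx : c * ‖x‖ ^ 2 ≤ ‖B x‖ ^ 2) :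
    ‖x - η • B.adjoint (B x)‖ ≤ (1 - 7 / 8 * (η * c)) * ‖x‖ := by
  have hadj : ‖B.adjoint (B x)‖ ^ 2 ≤ l ^ 2 * ‖B x‖ ^ 2 := by
    rw [← mul_pow]
    refine pow_le_pow_left₀ (norm_nonneg _) ?_ 2
    refine (B.adjoint.le_opNorm _).trans (mul_le_mul_of_nonneg_right ?_ (norm_nonneg _))
    rwa [LinearIsometryEquiv.norm_map]
  have hsq : ‖x - η • B.adjoint (B x)‖ ^ 2
      = ‖x‖ ^ 2 - 2 * η * ‖B x‖ ^ 2 + η ^ 2 * ‖B.adjoint (B x)‖ ^ 2 := by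
    rw [norm_sub_sq_real, inner_smul_right, ContinuousLinearMap.adjoint_inner_right,
      real_inner_self_eq_norm_sq, norm_smul, Real.norm_eq_abs, mul_pow, sq_abs]
    ring
  have h0 : 0 ≤ (1 - 7 / 8 * (η * c)) * ‖x‖ := mul_nonneg (by linarith) (norm_nonneg _)
  refine le_of_sq_le_sq ?_ h0
  rw [hsq, mul_pow]
  have h1 : η ^ 2 * ‖B.adjoint (B x)‖ ^ 2 ≤ η * (1 / 4) * ‖B x‖ ^ 2 := by
    calc η ^ 2 * ‖B.adjoint (B x)‖ ^ 2 ≤ η ^ 2 * (l ^ 2 * ‖B x‖ ^ 2) := by gcongr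
      _ = η * (η * l ^ 2) * ‖B x‖ ^ 2 := by ring
      _ ≤ _ := by gcongr
  have h2 : 7 / 4 * (η * (c * ‖x‖ ^ 2)) ≤ 7 / 4 * (η * ‖B x‖ ^ 2) := by gcongr
  have h3 : 0 ≤ (7 / 8 * (η * c)) ^ 2 * ‖x‖ ^ 2 := by positivity
  linarith

/-- If `A` and `A'` are close to `A₀`, whose Gram operator is at least `7c/8`, then the residual
contracts under the step `I - η A'ᵀ A`. -/
lemma norm_sub_smul_perturbed_le {A₀ A A' : X →L[ℝ] Y} {η l c ε : ℝ} (hη : 0 ≤ η)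
    (hA₀ : ‖A₀‖ ≤ l) (hA' : ‖A'‖ ≤ l) (hε : ‖A - A₀‖ ≤ ε) (hε' : ‖A' - A₀‖ ≤ ε)
    (hηl : η * l ^ 2 ≤ 1 / 4) (hηc : η * c ≤ 1) (hc : 0 ≤ c) (hlε : 8 * l * ε ≤ c)
    (hlow : ∀ u, 7 / 8 * c * ‖u‖ ^ 2 ≤ ‖A₀ u‖ ^ 2) (u : X) :
    ‖u - η • A'.adjoint (A u)‖ ≤ (1 - c * η / 2) * ‖u‖ := by
  have hl : 0 ≤ l := (norm_nonneg _).trans hA₀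
  have hε0 : 0 ≤ ε := (norm_nonneg _).trans hε
  have key : u - η • A'.adjoint (A u) = (u - η • A₀.adjoint (A₀ u))
      - η • (A'.adjoint ((A - A₀) u)) - η • ((A' - A₀).adjoint (A₀ u)) := by
    simp only [map_sub, sub_apply, smul_sub]
    abel
  have h1 := norm_sub_smul_adjoint_apply_le A₀ (c := 7 / 8 * c) hη hA₀ hηl
    (by nlinarith [mul_nonneg hη hc]) u (hlow u)
  have h2 : ‖A'.adjoint ((A - A₀) u)‖ ≤ l * (ε * ‖u‖) := by
    refine (A'.adjoint.le_opNorm _).trans ?_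
    rw [LinearIsometryEquiv.norm_map]
    exact mul_le_mul hA' (((A - A₀).le_opNorm u).trans (by gcongr)) (norm_nonneg _) hl
  have h3 : ‖(A' - A₀).adjoint (A₀ u)‖ ≤ ε * (l * ‖u‖) := by
    refine ((A' - A₀).adjoint.le_opNorm _).trans ?_
    rw [LinearIsometryEquiv.norm_map]
    exact mul_le_mul hε' ((A₀.le_opNorm u).trans (by gcongr)) (norm_nonneg _) hε0
  have h4 : ‖u - η • A'.adjoint (A u)‖ ≤ (1 - 7 / 8 * (η * (7 / 8 * c))) * ‖u‖
      + η * (l * (ε * ‖u‖)) + η * (ε * (l * ‖u‖)) := by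
    rw [key]
    refine (norm_sub_le _ _).trans (add_le_add ((norm_sub_le _ _).trans (add_le_add h1 ?_)) ?_)
    · rw [norm_smul, Real.norm_of_nonneg hη]; gcongr
    · rw [norm_smul, Real.norm_of_nonneg hη]; gcongr
  have h5 : η * (8 * l * ε) * ‖u‖ ≤ η * c * ‖u‖ := by gcongr
  have h6 : 0 ≤ η * c * ‖u‖ := by positivity
  linarith

/-- A lower bound for the Gram operator `A†A` gives the same lower bound for `AA†` on the range
of `A`. -/
lemma le_norm_adjoint_apply_sq {A : X →L[ℝ] Y} {c : ℝ} (hlow : ∀ u, c * ‖u‖ ^ 2 ≤ ‖A u‖ ^ 2)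
    (hc : 0 ≤ c) (u : X) : c * ‖A u‖ ^ 2 ≤ ‖A.adjoint (A u)‖ ^ 2 := by
  have h1 : ‖A u‖ ^ 2 ≤ ‖u‖ * ‖A.adjoint (A u)‖ := by
    rw [← real_inner_self_eq_norm_sq, ← ContinuousLinearMap.adjoint_inner_right]
    exact real_inner_le_norm _ _
  rcases (norm_nonneg (A u)).eq_or_lt with h0 | h0
  · rw [← h0]; simp
  have h2 := pow_le_pow_left₀ (sq_nonneg _) h1 2
  have h3 : c * ‖A u‖ ^ 2 * ‖A u‖ ^ 2 ≤ ‖A.adjoint (A u)‖ ^ 2 * ‖A u‖ ^ 2 := by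
    calc c * ‖A u‖ ^ 2 * ‖A u‖ ^ 2 = c * (‖A u‖ ^ 2) ^ 2 := by ring
      _ ≤ c * (‖u‖ * ‖A.adjoint (A u)‖) ^ 2 := by gcongr
      _ = (c * ‖u‖ ^ 2) * ‖A.adjoint (A u)‖ ^ 2 := by ring
      _ ≤ ‖A u‖ ^ 2 * ‖A.adjoint (A u)‖ ^ 2 := by gcongr; exact hlow u
      _ = _ := by ring
  exact le_of_mul_le_mul_right h3 (by positivity)

/-- Comparison of an inexact gradient descent with the limit `wL` of the linearized one.
Here `A₀` is the transposed Jacobian at the start and `A k` the one at step `k`. The part of the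
trajectory outside the range of `A₀` is collected in `s`; what remains stays in the range of `A₀`,
where the linearized step contracts. -/
lemma norm_sub_le_of_inexact_descent {A₀ : X →L[ℝ] Y} {A : ℕ → X →L[ℝ] Y} {w : ℕ → Y}
    {u : ℕ → X} {η l c ε U : ℝ} (hη : 0 < η) (hA₀ : ‖A₀‖ ≤ l)
    (hε : ∀ k, ‖A k - A₀‖ ≤ ε) (hA : ∀ k, ‖A k‖ ≤ l)
    (hηl : η * l ^ 2 ≤ 1 / 4) (hηc : η * c ≤ 1) (hc : 0 < c)
    (hlow : ∀ u, 7 / 8 * c * ‖u‖ ^ 2 ≤ ‖A₀ u‖ ^ 2)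
    (hw : ∀ k, w (k + 1) = w k - η • A k (u k))
    (hu : ∀ k, ‖u k‖ ≤ (1 - c * η / 2) ^ k * U)
    (hlin : ∀ k, ‖u k - u 0 - A₀.adjoint (w k - w 0)‖ ≤ ε * ‖w k - w 0‖)
    {wL : Y} {ζ : X} (hζ : wL - w 0 = A₀ ζ) (hwL : A₀.adjoint (wL - w 0) = - u 0) (k : ℕ) :
    ‖w k - wL‖ ≤ (1 - c * η / 2) ^ k * ‖w 0 - wL‖ +
      (2 * ε * U / c + 8 * l ^ 2 * ε * U / c ^ 2) := by
  have hl : 0 ≤ l := (norm_nonneg _).trans hA₀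
  have hε0 : 0 ≤ ε := (norm_nonneg _).trans (hε 0)
  have hU : 0 ≤ U := by simpa using (norm_nonneg _).trans (hu 0)
  set ρ := 1 - c * η / 2 with hρ
  have hcη : 0 < c * η := by positivity
  have hρ0 : 0 ≤ ρ := by rw [hρ]; linarith
  have hρ1 : ρ < 1 := by rw [hρ]; linarith
  have h1ρ : 1 - ρ = c * η / 2 := by rw [hρ]; ring
  let s : ℕ → Y := fun k => ∑ j ∈ Finset.range k, η • (A j - A₀) (u j)
  have hs_succ : ∀ k, s (k + 1) = s k + η • (A k - A₀) (u k) := fun k =>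
    Finset.sum_range_succ _ _
  have hs0 : s 0 = 0 := by simp [s]
  have hs : ∀ k, ‖s k‖ ≤ 2 * ε * U / c := by
    intro k
    have := norm_sub_zero_le_of_geometric (s := s) (B := η * (ε * U)) hρ0 hρ1 (by positivity)
      (fun j => by
        rw [hs_succ, add_sub_cancel_left, norm_smul, Real.norm_of_nonneg hη.le]
        calc η * ‖(A j - A₀) (u j)‖ ≤ η * (ε * (ρ ^ j * U)) := by
              gcongr
              exact ((A j - A₀).le_opNorm _).trans
                (mul_le_mul (hε j) (hu j) (norm_nonneg _) hε0)
          _ = _ := by ring) k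
    rw [hs0, sub_zero, h1ρ] at this
    refine this.trans (le_of_eq ?_)
    field_simp
  have hD : ∀ k, ‖w k - w 0‖ ≤ 2 * l * U / c := by
    intro k
    have := norm_sub_zero_le_of_geometric (s := w) (B := η * (l * U)) hρ0 hρ1 (by positivity)
      (fun j => by
        rw [hw, sub_sub_cancel_left, norm_neg, norm_smul, Real.norm_of_nonneg hη.le]
        calc η * ‖A j (u j)‖ ≤ η * (l * (ρ ^ j * U)) := by
              gcongr
              exact ((A j).le_opNorm _).trans (mul_le_mul (hA j) (hu j) (norm_nonneg _) hl)
          _ = _ := by ring) k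
    rw [h1ρ] at this
    refine this.trans (le_of_eq ?_)
    field_simp
  -- `z k` stays in the range of `A₀` because it moves by `A₀ (u k)` only.
  let z : ℕ → Y := fun k => w k - wL + s k
  have hz_succ : ∀ k, z (k + 1) = z k - η • A₀ (u k) := by
    intro k
    simp only [z, hs_succ, hw, sub_apply, smul_sub]
    abel
  have hz0 : z 0 = w 0 - wL := by simp [z, hs0]
  have hrange : ∀ k, ∃ v, z k = A₀ v := by
    intro k
    induction k with
    | zero => exact ⟨-ζ, by rw [hz0, map_neg, ← hζ]; abel⟩
    | succ k ih =>
      obtain ⟨v, hv⟩ := ih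
      exact ⟨v - η • u k, by rw [hz_succ, hv, map_sub, map_smul]⟩
  have hl2 : ‖A₀.adjoint‖ ≤ l := by rwa [LinearIsometryEquiv.norm_map]
  have hq : ∀ k, ‖A₀ (u k - A₀.adjoint (z k))‖ ≤ 4 * l ^ 2 * ε * U / c := by
    intro k
    have h1 : u k - A₀.adjoint (z k)
        = (u k - u 0 - A₀.adjoint (w k - w 0)) - A₀.adjoint (s k) := by
      have : z k = (w k - w 0) - (wL - w 0) + s k := by simp only [z]; abel
      rw [this, map_add, map_sub, hwL]
      abel
    have h2 : ‖u k - A₀.adjoint (z k)‖ ≤ ε * (2 * l * U / c) + l * (2 * ε * U / c) := by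
      rw [h1]
      refine (norm_sub_le _ _).trans (add_le_add ((hlin k).trans ?_) ?_)
      · exact mul_le_mul_of_nonneg_left (hD k) hε0
      · exact (A₀.adjoint.le_opNorm _).trans (mul_le_mul hl2 (hs k) (norm_nonneg _) hl)
    refine (A₀.le_opNorm _).trans ((mul_le_mul hA₀ h2 (norm_nonneg _) hl).trans (le_of_eq ?_))
    ring
  have hstep : ∀ k, ‖z (k + 1)‖ ≤ ρ * ‖z k‖ + η * (4 * l ^ 2 * ε * U / c) := by
    intro k
    obtain ⟨v, hv⟩ := hrange k
    have h1 : z (k + 1) = (z k - η • A₀ (A₀.adjoint (z k)))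
        - η • A₀ (u k - A₀.adjoint (z k)) := by
      rw [hz_succ, map_sub, smul_sub]
      abel
    have h2 : 7 / 8 * c * ‖z k‖ ^ 2 ≤ ‖A₀.adjoint (z k)‖ ^ 2 := by
      rw [hv]
      exact le_norm_adjoint_apply_sq hlow (by positivity) v
    have h3 := norm_sub_smul_adjoint_apply_le A₀.adjoint (c := 7 / 8 * c) hη.le hl2 hηl
      (by linarith) (z k) h2
    rw [ContinuousLinearMap.adjoint_adjoint] at h3
    rw [h1]
    refine (norm_sub_le _ _).trans (add_le_add (h3.trans ?_) ?_)
    · refine mul_le_mul_of_nonneg_right ?_ (norm_nonneg _)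
      rw [hρ]
      linarith
    · rw [norm_smul, Real.norm_of_nonneg hη.le]
      gcongr
      exact hq k
  have hz : ∀ k, ‖z k‖ ≤ ρ ^ k * ‖w 0 - wL‖ + 8 * l ^ 2 * ε * U / c ^ 2 := by
    intro k
    induction k with
    | zero =>
      rw [hz0, pow_zero, one_mul]
      have : 0 ≤ 8 * l ^ 2 * ε * U / c ^ 2 := by positivity
      linarith
    | succ k ih =>
      refine (hstep k).trans ?_
      have h1 := mul_le_mul_of_nonneg_left ih hρ0
      have h2 : η * (4 * l ^ 2 * ε * U / c) = (1 - ρ) * (8 * l ^ 2 * ε * U / c ^ 2) := by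
        rw [h1ρ]
        field_simp
        ring
      rw [h2, pow_succ ρ]
      linarith
  have hfin : w k - wL = z k - s k := by simp [z]
  rw [hfin]
  refine (norm_sub_le _ _).trans ((add_le_add (hz k) (hs k)).trans (le_of_eq ?_))
  ring

end Hilbert

/-! ### Transposed Jacobians -/

section RowComb

variable {n : ℕ} {W : Type*} [NormedAddCommGroup W] [InnerProductSpace ℝ W]

/-- The operator `u ↦ ∑ i, u i • G i`, the transpose of the matrix with rows `G i`. -/
def rowComb (G : Fin n → W) : EuclideanSpace ℝ (Fin n) →L[ℝ] W :=
  ∑ i, (EuclideanSpace.proj i : EuclideanSpace ℝ (Fin n) →L[ℝ] ℝ).smulRight (G i)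

lemma rowComb_apply (G : Fin n → W) (u : EuclideanSpace ℝ (Fin n)) :
    rowComb G u = ∑ i, u i • G i := by
  simp [rowComb, sum_apply]

lemma adjoint_rowComb_apply [CompleteSpace W] (G : Fin n → W) (w : W) (i : Fin n) :
    (rowComb G).adjoint w i = inner ℝ (G i) w := by
  have h := ContinuousLinearMap.adjoint_inner_right (rowComb G) (EuclideanSpace.single i 1) w
  rw [EuclideanSpace.inner_single_left, rowComb_apply] at h
  simpa using h

lemma norm_rowComb_le (G : Fin n → W) : ‖rowComb G‖ ≤ √(∑ i, ‖G i‖ ^ 2) := by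
  refine ContinuousLinearMap.opNorm_le_bound _ (Real.sqrt_nonneg _) fun u => ?_
  rw [rowComb_apply, EuclideanSpace.norm_eq, mul_comm]
  refine (norm_sum_le _ _).trans ?_
  simp_rw [norm_smul]
  exact Real.sum_mul_le_sqrt_mul_sqrt _ _ _

lemma rowComb_sub (G G' : Fin n → W) : rowComb G - rowComb G' = rowComb (G - G') := by
  ext1 u
  simp [rowComb_apply, smul_sub, Finset.sum_sub_distrib]

lemma norm_rowComb_apply_sq (G : Fin n → W) (u : EuclideanSpace ℝ (Fin n)) :
    ‖rowComb G u‖ ^ 2 = ∑ i, ∑ j, u i * u j * inner ℝ (G i) (G j) := by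
  rw [← real_inner_self_eq_norm_sq, rowComb_apply, sum_inner]
  refine Finset.sum_congr rfl fun i _ => ?_
  rw [inner_sum]
  refine Finset.sum_congr rfl fun j _ => ?_
  rw [real_inner_smul_left, real_inner_smul_right]
  ring

end RowComb

variable {d n m : ℕ}

/-- The `r`-th block of the gradient of the network when the activation has slope `s r` at the
`r`-th neuron. -/
def slopeGrad (a : Fin m → ℝ) (x : Input d) (s : Fin m → ℝ) : Weights d m :=
  WithLp.toLp 2 fun r => (a r / √(m : ℝ) * s r) • aug x

/-- The activation pattern of the network: the slopes of the ReLU at the neurons. -/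
def pattern (w : Weights d m) (x : Input d) (r : Fin m) : ℝ :=
  reluDeriv (inner ℝ (w r) (aug x))

lemma gradNet_eq_slopeGrad (a : Fin m → ℝ) (x : Input d) (w : Weights d m) :
    gradNet a x w = slopeGrad a x (pattern w x) := rfl

/-- The transposed Jacobian of the network on the data for the activation slopes `S`. -/
def jac (a : Fin m → ℝ) (x : Fin n → Input d) (S : Fin n → Fin m → ℝ) :
    EuclideanSpace ℝ (Fin n) →L[ℝ] Weights d m :=
  rowComb fun i => slopeGrad a (x i) (S i)

/-- The vector of residuals `f(x_i, w) - y_i`. -/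
def resid (a : Fin m → ℝ) (x : Fin n → Input d) (y : Fin n → ℝ) (w : Weights d m) :
    EuclideanSpace ℝ (Fin n) :=
  WithLp.toLp 2 fun i => net a (x i) w - y i

lemma gd_succ (a : Fin m → ℝ) (x : Fin n → Input d) (y : Fin n → ℝ) (η : ℝ) (w0 : Weights d m)
    (k : ℕ) : gd a x y η w0 (k + 1) = gd a x y η w0 k -
      η • jac a x (fun i => pattern (gd a x y η w0 k) (x i)) (resid a x y (gd a x y η w0 k)) := by
  rw [gd, jac, rowComb_apply]
  rfl

lemma norm_aug_sq (x : Input d) : ‖aug x‖ ^ 2 = ‖x‖ ^ 2 + 1 := by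
  rw [EuclideanSpace.real_norm_sq_eq, EuclideanSpace.real_norm_sq_eq, Fin.sum_univ_castSucc]
  simp [aug]

lemma aug_ne_zero (x : Input d) : aug x ≠ 0 := by
  intro h
  have := norm_aug_sq x
  rw [h, norm_zero] at this
  nlinarith [sq_nonneg ‖x‖]

lemma norm_aug_sq_le {x : Input d} (hd : 0 < d) (hx : ‖x‖ = √(d : ℝ)) :
    ‖aug x‖ ^ 2 ≤ 2 * d := by
  have : (1 : ℝ) ≤ d := by exact_mod_cast hd
  rw [norm_aug_sq, hx, Real.sq_sqrt (by positivity)]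
  linarith

lemma inner_slopeGrad (a : Fin m → ℝ) (x : Input d) (s : Fin m → ℝ) (w : Weights d m) :
    inner ℝ (slopeGrad a x s) w = ∑ r, a r / √(m : ℝ) * (s r * inner ℝ (w r) (aug x)) := by
  rw [PiLp.inner_apply]
  refine Finset.sum_congr rfl fun r _ => ?_
  simp only [slopeGrad]
  rw [real_inner_smul_left, real_inner_comm]
  ring

lemma norm_slopeGrad_sq (a : Fin m → ℝ) (x : Input d) (s : Fin m → ℝ) :
    ‖slopeGrad a x s‖ ^ 2 = ∑ r, a r ^ 2 / m * s r ^ 2 * ‖aug x‖ ^ 2 := by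
  rw [PiLp.norm_sq_eq_of_L2]
  refine Finset.sum_congr rfl fun r _ => ?_
  simp only [slopeGrad]
  rw [norm_smul, mul_pow, Real.norm_eq_abs, sq_abs, mul_pow, div_pow,
    Real.sq_sqrt (Nat.cast_nonneg m)]

lemma norm_slopeGrad_sq_le {a : Fin m → ℝ} (ha : ∀ r, |a r| ≤ 1) {x : Input d} (hd : 0 < d)
    (hx : ‖x‖ = √(d : ℝ)) (s : Fin m → ℝ) :
    ‖slopeGrad a x s‖ ^ 2 ≤ 2 * d / m * ∑ r, s r ^ 2 := by
  rw [norm_slopeGrad_sq, Finset.mul_sum]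
  refine Finset.sum_le_sum fun r _ => ?_
  have h1 : a r ^ 2 ≤ 1 := by rw [← sq_abs]; exact pow_le_one₀ (abs_nonneg _) (ha r)
  calc a r ^ 2 / m * s r ^ 2 * ‖aug x‖ ^ 2 ≤ 1 / m * s r ^ 2 * (2 * d) := by
        gcongr
        exact norm_aug_sq_le hd hx
    _ = _ := by ring

lemma norm_jac_le {a : Fin m → ℝ} (ha : ∀ r, |a r| ≤ 1) {x : Fin n → Input d} (hd : 0 < d)
    (hm : 0 < m) (hx : ∀ i, ‖x i‖ = √(d : ℝ)) {S : Fin n → Fin m → ℝ}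
    (hS : ∀ i r, S i r ∈ Set.Icc (0 : ℝ) 1) : ‖jac a x S‖ ≤ √(2 * (d * n)) := by
  refine (norm_rowComb_le _).trans (Real.sqrt_le_sqrt ?_)
  have h1 : ∀ i, ‖slopeGrad a (x i) (S i)‖ ^ 2 ≤ 2 * d := by
    intro i
    refine (norm_slopeGrad_sq_le ha hd (hx i) (S i)).trans ?_
    have : ∑ r, S i r ^ 2 ≤ (m : ℝ) := by
      refine (Finset.sum_le_card_nsmul _ _ 1 fun r _ =>
        pow_le_one₀ (hS i r).1 (hS i r).2).trans ?_
      simp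
    calc 2 * (d : ℝ) / m * ∑ r, S i r ^ 2 ≤ 2 * d / m * m := by gcongr
      _ = 2 * d := by field_simp
  refine (Finset.sum_le_sum fun i _ => h1 i).trans (le_of_eq ?_)
  simp
  ring

lemma slopeGrad_sub (a : Fin m → ℝ) (x : Input d) (s s' : Fin m → ℝ) :
    slopeGrad a x s - slopeGrad a x s' = slopeGrad a x (s - s') := by
  ext r : 1
  simp only [slopeGrad, PiLp.sub_apply, Pi.sub_apply]
  rw [← sub_smul]
  ring_nf

lemma norm_jac_sub_le {a : Fin m → ℝ} (ha : ∀ r, |a r| ≤ 1) {x : Fin n → Input d} (hd : 0 < d)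
    (hx : ∀ i, ‖x i‖ = √(d : ℝ)) (S S' : Fin n → Fin m → ℝ) :
    ‖jac a x S - jac a x S'‖ ≤ √(2 * d / m * ∑ i, ∑ r, (S i r - S' i r) ^ 2) := by
  rw [jac, jac, rowComb_sub]
  refine (norm_rowComb_le _).trans (Real.sqrt_le_sqrt ?_)
  rw [Finset.mul_sum]
  refine Finset.sum_le_sum fun i _ => ?_
  rw [Pi.sub_apply, slopeGrad_sub]
  exact norm_slopeGrad_sq_le ha hd (hx i) _

/-- The weights of a single neuron move slowly: the blocks of the gradient are of size
`1 / √m`. -/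
lemma norm_jac_apply_block_le {a : Fin m → ℝ} (ha : ∀ r, |a r| ≤ 1) {x : Fin n → Input d}
    (hd : 0 < d) (hx : ∀ i, ‖x i‖ = √(d : ℝ)) {S : Fin n → Fin m → ℝ}
    (hS : ∀ i r, S i r ∈ Set.Icc (0 : ℝ) 1) (u : EuclideanSpace ℝ (Fin n)) (r : Fin m) :
    ‖jac a x S u r‖ ≤ √(2 * (d * n)) / √(m : ℝ) * ‖u‖ := by
  have h1 : jac a x S u r = rowComb (fun i => (a r / √(m : ℝ) * S i r) • aug (x i)) u := by
    rw [jac, rowComb_apply, rowComb_apply]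
    simp [slopeGrad]
  rw [h1]
  refine (ContinuousLinearMap.le_opNorm _ _).trans
    (mul_le_mul_of_nonneg_right ((norm_rowComb_le _).trans ?_) (norm_nonneg _))
  rw [← Real.sqrt_div (by positivity)]
  refine Real.sqrt_le_sqrt ?_
  have h2 : ∀ i, ‖(a r / √(m : ℝ) * S i r) • aug (x i)‖ ^ 2 ≤ 1 / m * 1 * (2 * d) := by
    intro i
    rw [norm_smul, mul_pow, Real.norm_eq_abs, sq_abs, mul_pow, div_pow,
      Real.sq_sqrt (Nat.cast_nonneg m)]
    have h3 : a r ^ 2 ≤ 1 := by rw [← sq_abs]; exact pow_le_one₀ (abs_nonneg _) (ha r)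
    gcongr
    · exact pow_le_one₀ (hS i r).1 (hS i r).2
    · exact norm_aug_sq_le hd (hx i)
  refine (Finset.sum_le_sum fun i _ => h2 i).trans (le_of_eq ?_)
  simp
  ring

/-! ### Secant slopes of the ReLU -/

lemma reluDeriv_mem (z : ℝ) : reluDeriv z ∈ Set.Icc (0 : ℝ) 1 := by
  unfold reluDeriv
  split_ifs <;> simp

/-- The slope of the secant of the ReLU between `z` and `z'`. -/
def secant (z z' : ℝ) : ℝ := if z = z' then reluDeriv z else (relu z' - relu z) / (z' - z)

lemma secant_mul (z z' : ℝ) : secant z z' * (z' - z) = relu z' - relu z := by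
  unfold secant
  split_ifs with h
  · simp [h]
  · rw [div_mul_cancel₀]
    exact fun h' => h (by linarith)

lemma secant_mem (z z' : ℝ) : secant z z' ∈ Set.Icc (0 : ℝ) 1 := by
  unfold secant
  split_ifs with h
  · exact reluDeriv_mem z
  · rcases lt_or_gt_of_ne h with h | h
    · refine ⟨div_nonneg ?_ (by linarith), (div_le_one (by linarith)).2 ?_⟩
      · exact sub_nonneg.2 (max_le_max_right 0 h.le)
      · unfold relu
        rcases max_cases z 0 with h1 | h1 <;> rcases max_cases z' 0 with h2 | h2 <;> linarith
    · refine ⟨div_nonneg_of_nonpos ?_ (by linarith), (div_le_one_of_neg (by linarith)).2 ?_⟩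
      · exact sub_nonpos.2 (max_le_max_right 0 h.le)
      · unfold relu
        rcases max_cases z 0 with h1 | h1 <;> rcases max_cases z' 0 with h2 | h2 <;> linarith

lemma reluDeriv_eq_of_abs_sub_lt {z z₀ : ℝ} (h : |z - z₀| < |z₀|) : reluDeriv z = reluDeriv z₀ := by
  unfold reluDeriv
  rcases le_or_gt 0 z₀ with h0 | h0
  · rw [abs_of_nonneg h0, abs_lt] at h
    rw [if_pos h0, if_pos (by linarith)]
  · rw [abs_of_neg h0, abs_lt] at h
    rw [if_neg (by linarith), if_neg (by linarith)]

lemma secant_eq_of_abs_sub_lt {z z' z₀ : ℝ} (h : |z - z₀| < |z₀|) (h' : |z' - z₀| < |z₀|) :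
    secant z z' = reluDeriv z₀ := by
  by_cases hz : z = z'
  · rw [secant, if_pos hz, reluDeriv_eq_of_abs_sub_lt h]
  have hne : z' - z ≠ 0 := fun h => hz (by linarith)
  rw [secant, if_neg hz, div_eq_iff hne]
  unfold reluDeriv relu
  rcases le_or_gt 0 z₀ with h0 | h0
  · rw [abs_of_nonneg h0, abs_lt] at h h'
    rw [if_pos h0, max_eq_left (by linarith), max_eq_left (by linarith), one_mul]
  · rw [abs_of_neg h0, abs_lt] at h h'
    rw [if_neg (by linarith), max_eq_right (by linarith), max_eq_right (by linarith)]
    ring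

/-- The secant slopes of all neurons between the weights `w` and `w'`. -/
def secantPattern (w w' : Weights d m) (x : Input d) (r : Fin m) : ℝ :=
  secant (inner ℝ (w r) (aug x)) (inner ℝ (w' r) (aug x))

lemma net_sub_net (a : Fin m → ℝ) (x : Input d) (w w' : Weights d m) :
    net a x w' - net a x w = inner ℝ (slopeGrad a x (secantPattern w w' x)) (w' - w) := by
  rw [inner_slopeGrad, net, net, ← Finset.sum_sub_distrib]
  refine Finset.sum_congr rfl fun r _ => ?_
  rw [← mul_sub, PiLp.sub_apply, inner_sub_left, secantPattern, secant_mul]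

/-- With secant slopes in place of derivatives, the increment of the residual is exactly linear in
the increment of the weights. -/
lemma resid_sub_resid (a : Fin m → ℝ) (x : Fin n → Input d) (y : Fin n → ℝ) (w w' : Weights d m) :
    resid a x y w' - resid a x y w =
      (jac a x fun i => secantPattern w w' (x i)).adjoint (w' - w) := by
  ext i
  rw [jac, adjoint_rowComb_apply, ← net_sub_net]
  simp [resid]

/-! ### Neurons that may change their activation -/

/-- Indicator of the neurons whose hyperplane is within distance `R` of the weights, which are the
only ones whose activation on `x` can change while their weights move by at most `R`. -/
def nearIndicator (R : ℝ) (v : Neuron d) (x : Input d) : ℝ :=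
  if |inner ℝ v (aug x)| ≤ R * ‖aug x‖ then 1 else 0

lemma nearIndicator_nonneg (R : ℝ) (v : Neuron d) (x : Input d) : 0 ≤ nearIndicator R v x := by
  unfold nearIndicator
  split_ifs <;> simp

lemma abs_inner_sub_lt {R : ℝ} {v v₀ : Neuron d} {x : Input d} (h : ‖v - v₀‖ ≤ R)
    (hn : ¬ |inner ℝ v₀ (aug x)| ≤ R * ‖aug x‖) :
    |(inner ℝ v (aug x) : ℝ) - inner ℝ v₀ (aug x)| < |inner ℝ v₀ (aug x)| := by
  rw [← inner_sub_left]
  refine ((abs_real_inner_le_norm _ _).trans ?_).trans_lt (not_le.1 hn)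
  gcongr

lemma sq_sub_le_nearIndicator {s t R : ℝ} {v : Neuron d} {x : Input d}
    (hs : s ∈ Set.Icc (0 : ℝ) 1) (ht : t ∈ Set.Icc (0 : ℝ) 1)
    (h : ¬ |inner ℝ v (aug x)| ≤ R * ‖aug x‖ → s = t) : (s - t) ^ 2 ≤ nearIndicator R v x := by
  unfold nearIndicator
  split_ifs with h1
  · obtain ⟨h2, h3⟩ := hs
    obtain ⟨h4, h5⟩ := ht
    nlinarith
  · rw [h h1]
    simp

lemma norm_jac_secantPattern_sub_le {a : Fin m → ℝ} (ha : ∀ r, |a r| ≤ 1) {x : Fin n → Input d}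
    (hd : 0 < d) (hx : ∀ i, ‖x i‖ = √(d : ℝ)) {R ε : ℝ} {w0 w w' : Weights d m} (hε : 0 ≤ ε)
    (hnear : 2 * (d : ℝ) / m * ∑ i, ∑ r, nearIndicator R (w0 r) (x i) ≤ ε ^ 2)
    (hw : ∀ r, ‖w r - w0 r‖ ≤ R) (hw' : ∀ r, ‖w' r - w0 r‖ ≤ R) :
    ‖(jac a x fun i => secantPattern w w' (x i)) - jac a x fun i => pattern w0 (x i)‖ ≤ ε := by
  refine (norm_jac_sub_le ha hd hx _ _).trans (Real.sqrt_le_iff.2 ⟨hε, le_trans ?_ hnear⟩)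
  gcongr with i _ r _
  refine sq_sub_le_nearIndicator (secant_mem _ _) (reluDeriv_mem _) fun h => ?_
  exact secant_eq_of_abs_sub_lt (abs_inner_sub_lt (hw r) h) (abs_inner_sub_lt (hw' r) h)

lemma norm_jac_pattern_sub_le {a : Fin m → ℝ} (ha : ∀ r, |a r| ≤ 1) {x : Fin n → Input d}
    (hd : 0 < d) (hx : ∀ i, ‖x i‖ = √(d : ℝ)) {R ε : ℝ} {w0 w : Weights d m} (hε : 0 ≤ ε)
    (hnear : 2 * (d : ℝ) / m * ∑ i, ∑ r, nearIndicator R (w0 r) (x i) ≤ ε ^ 2)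
    (hw : ∀ r, ‖w r - w0 r‖ ≤ R) :
    ‖(jac a x fun i => pattern w (x i)) - jac a x fun i => pattern w0 (x i)‖ ≤ ε := by
  refine (norm_jac_sub_le ha hd hx _ _).trans (Real.sqrt_le_iff.2 ⟨hε, le_trans ?_ hnear⟩)
  gcongr with i _ r _
  refine sq_sub_le_nearIndicator (reluDeriv_mem _) (reluDeriv_mem _) fun h => ?_
  exact reluDeriv_eq_of_abs_sub_lt (abs_inner_sub_lt (hw r) h)

/-! ### The minimum norm interpolator -/

/-- If the Gram operator `A†A` is bounded below, then `A† v = b` has a solution `v` in the range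
of `A`. -/
lemma exists_adjoint_apply_eq {Y : Type*} [NormedAddCommGroup Y]
    [InnerProductSpace ℝ Y] [CompleteSpace Y] {A : EuclideanSpace ℝ (Fin n) →L[ℝ] Y} {c : ℝ}
    (hc : 0 < c) (hlow : ∀ u, c * ‖u‖ ^ 2 ≤ ‖A u‖ ^ 2) (b : EuclideanSpace ℝ (Fin n)) :
    ∃ ζ, A.adjoint (A ζ) = b := by
  have hinj : Function.Injective (A.adjoint ∘L A).toLinearMap := by
    refine (injective_iff_map_eq_zero _).2 fun u hu => ?_
    have h1 : ‖A u‖ ^ 2 = 0 := by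
      rw [← real_inner_self_eq_norm_sq, ← ContinuousLinearMap.adjoint_inner_right]
      have : A.adjoint (A u) = 0 := hu
      rw [this, inner_zero_right]
    have h2 := hlow u
    rw [h1] at h2
    have h3 : ‖u‖ ^ 2 ≤ 0 := by
      by_contra h
      nlinarith
    exact norm_eq_zero.1 (pow_eq_zero_iff two_ne_zero |>.1 (le_antisymm h3 (sq_nonneg _)))
  obtain ⟨ζ, hζ⟩ := LinearMap.surjective_of_injective hinj b
  exact ⟨ζ, hζ⟩

lemma linNet_eq_iff (a : Fin m → ℝ) (w0 : Weights d m) (x : Fin n → Input d) (y : Fin n → ℝ)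
    (w : Weights d m) : (∀ i, linNet a w0 (x i) w = y i) ↔
      (jac a x fun i => pattern w0 (x i)).adjoint (w - w0) = - resid a x y w0 := by
  constructor
  · intro h
    ext i
    rw [jac, adjoint_rowComb_apply, ← gradNet_eq_slopeGrad]
    have := h i
    rw [linNet] at this
    simp only [resid, PiLp.neg_apply]
    linarith
  · intro h i
    have := congrArg (fun v : EuclideanSpace ℝ (Fin n) => v i) h
    simp only [] at this
    rw [jac, adjoint_rowComb_apply, ← gradNet_eq_slopeGrad] at this
    simp only [resid, PiLp.neg_apply] at this
    rw [linNet]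
    linarith

/-- A solution of the linearized interpolation problem whose displacement lies in the range of the
transposed Jacobian is the unique minimum norm interpolator. -/
lemma isMinNormInterpolator_iff_eq {a : Fin m → ℝ} {w0 : Weights d m} {x : Fin n → Input d}
    {y : Fin n → ℝ} {wL : Weights d m} {ζ : EuclideanSpace ℝ (Fin n)}
    (hζ : wL - w0 = (jac a x fun i => pattern w0 (x i)) ζ)
    (hwL : (jac a x fun i => pattern w0 (x i)).adjoint (wL - w0) = - resid a x y w0)
    (w : Weights d m) : IsMinNormInterpolator a w0 x y w ↔ w = wL := by
  have pyth : ∀ w, (∀ i, linNet a w0 (x i) w = y i) →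
      ‖w - w0‖ ^ 2 = ‖wL - w0‖ ^ 2 + ‖w - wL‖ ^ 2 := by
    intro w hw
    rw [linNet_eq_iff] at hw
    have horth : (inner ℝ (wL - w0) (w - wL) : ℝ) = 0 := by
      have hd : w - wL = (w - w0) - (wL - w0) := by abel
      rw [hζ, ← ContinuousLinearMap.adjoint_inner_right, hd, map_sub, hw, hwL, sub_self,
        inner_zero_right]
    have hd : w - w0 = (wL - w0) + (w - wL) := by abel
    rw [hd, norm_add_sq_real, horth]
    ring
  have hL := (linNet_eq_iff a w0 x y wL).2 hwL
  constructor
  · rintro ⟨h1, h2⟩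
    have h3 := pyth w h1
    have h4 := pow_le_pow_left₀ (norm_nonneg _) (h2 wL hL) 2
    have h5 : ‖w - wL‖ ^ 2 = 0 := le_antisymm (by linarith) (sq_nonneg _)
    exact sub_eq_zero.1 (norm_eq_zero.1 (pow_eq_zero_iff two_ne_zero |>.1 h5))
  · rintro rfl
    refine ⟨hL, fun w' hw' => ?_⟩
    have h3 := pyth w' hw'
    exact le_of_sq_le_sq (by nlinarith [sq_nonneg ‖w' - w‖]) (norm_nonneg _)

/-! ### Gradient descent in the lazy regime -/

/-- Gradient descent for initializations that satisfy the three good events: the Gram matrix is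
well conditioned, the initial residual is at most `U`, and few neurons are near their
hyperplanes. -/
theorem gd_of_good_init {a : Fin m → ℝ} (ha : ∀ r, |a r| ≤ 1) {x : Fin n → Input d}
    {y : Fin n → ℝ} (hd : 0 < d) (hm : 0 < m) (hx : ∀ i, ‖x i‖ = √(d : ℝ)) {w0 : Weights d m}
    {η c ε U R : ℝ} (hη : 0 < η) (hc : 0 < c) (hε : 0 ≤ ε)
    (hηl : η * (2 * (d * n)) ≤ 1 / 4) (hηc : η * c ≤ 1) (hlε : 8 * √(2 * (d * n)) * ε ≤ c)
    (hlow : ∀ u, 7 / 8 * c * ‖u‖ ^ 2 ≤ ‖(jac a x fun i => pattern w0 (x i)) u‖ ^ 2)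
    (hU : ‖resid a x y w0‖ ≤ U) (hR : R = 2 * √(2 * (d * n)) * U / (c * √(m : ℝ)))
    (hnear : 2 * (d : ℝ) / m * ∑ i, ∑ r, nearIndicator R (w0 r) (x i) ≤ ε ^ 2) :
    ∃ wL : Weights d m, IsMinNormInterpolator a w0 x y wL ∧
      (∀ w, IsMinNormInterpolator a w0 x y w → w = wL) ∧
      (∀ k : ℕ, ‖gd a x y η w0 k - wL‖ ≤ (1 - c * η / 2) ^ k * ‖w0 - wL‖ +
        (2 * ε * U / c + 8 * (2 * (d * n)) * ε * U / c ^ 2)) ∧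
      ∃ wStar : Weights d m, Tendsto (fun k => gd a x y η w0 k) atTop (𝓝 wStar) := by
  set l := √(2 * ((d : ℝ) * n)) with hl
  have hl2 : l ^ 2 = 2 * ((d : ℝ) * n) := Real.sq_sqrt (by positivity)
  have hl0 : 0 ≤ l := Real.sqrt_nonneg _
  rw [← hl2] at hηl
  have hU0 : 0 ≤ U := (norm_nonneg _).trans hU
  set ρ := 1 - c * η / 2 with hρ
  have hcη : 0 < c * η := by positivity
  have hρ0 : 0 ≤ ρ := by rw [hρ]; linarith
  have hρ1 : ρ < 1 := by rw [hρ]; linarith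
  have hm0 : (0 : ℝ) < √(m : ℝ) := by positivity
  have hR0 : 0 ≤ R := by rw [hR]; positivity
  set w : ℕ → Weights d m := gd a x y η w0 with hwdef
  have hw0 : w 0 = w0 := rfl
  set u : ℕ → EuclideanSpace ℝ (Fin n) := fun k => resid a x y (w k) with hu
  set A : ℕ → EuclideanSpace ℝ (Fin n) →L[ℝ] Weights d m :=
    fun k => jac a x fun i => pattern (w k) (x i) with hA
  have hw : ∀ k, w (k + 1) = w k - η • A k (u k) := fun k => gd_succ a x y η w0 k
  have hAl : ∀ k, ‖A k‖ ≤ l := fun k => norm_jac_le ha hd hm hx fun i r => reluDeriv_mem _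
  have hsl : ∀ v v', ‖jac a x fun i => secantPattern v v' (x i)‖ ≤ l :=
    fun v v' => norm_jac_le ha hd hm hx fun i r => secant_mem _ _
  -- One step moves a neuron by at most `R (1 - ρ) ρ ^ k`.
  have hblock : ∀ k, ‖u k‖ ≤ ρ ^ k * U → (∀ r, ‖w k r - w0 r‖ ≤ R * (1 - ρ ^ k)) →
      ∀ r, ‖w (k + 1) r - w0 r‖ ≤ R * (1 - ρ ^ (k + 1)) := by
    intro k hk hr r
    have h1 : w (k + 1) r - w0 r = (w k r - w0 r) - η • (A k (u k) r) := by
      rw [hw, PiLp.sub_apply, PiLp.smul_apply]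
      abel
    have h2 : ‖η • (A k (u k) r)‖ ≤ R * ((1 - ρ) * ρ ^ k) := by
      rw [norm_smul, Real.norm_of_nonneg hη.le]
      calc η * ‖A k (u k) r‖ ≤ η * (l / √(m : ℝ) * (ρ ^ k * U)) := by
            gcongr
            exact (norm_jac_apply_block_le ha hd hx (fun i r => reluDeriv_mem _) _ _).trans
              (by gcongr)
        _ = R * ((1 - ρ) * ρ ^ k) := by
            rw [hR, show 1 - ρ = c * η / 2 by rw [hρ]; ring]
            field_simp
    rw [h1]
    refine (norm_sub_le _ _).trans ((add_le_add (hr r) h2).trans (le_of_eq ?_))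
    ring
  have hinv : ∀ k, ‖u k‖ ≤ ρ ^ k * U ∧ ∀ r, ‖w k r - w0 r‖ ≤ R * (1 - ρ ^ k) := by
    intro k
    induction k with
    | zero => exact ⟨by rw [pow_zero, one_mul]; exact hU, fun r => by simp [hw0]⟩
    | succ k ih =>
      obtain ⟨ih1, ih2⟩ := ih
      have hnext := hblock k ih1 ih2
      refine ⟨?_, hnext⟩
      have hle : ∀ j, R * (1 - ρ ^ j) ≤ R := fun j =>
        mul_le_of_le_one_right hR0 (by linarith [pow_nonneg hρ0 j])
      have hstep : u (k + 1) = u k - η •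
          (jac a x fun i => secantPattern (w k) (w (k + 1)) (x i)).adjoint (A k (u k)) := by
        have h1 := resid_sub_resid a x y (w k) (w (k + 1))
        have h2 : w (k + 1) - w k = - (η • A k (u k)) := by rw [hw]; abel
        conv_rhs at h1 => rw [h2, map_neg, map_smul]
        rw [sub_eq_iff_eq_add] at h1
        simp only [hu] at h1 ⊢
        rw [h1]
        abel
      rw [hstep]
      refine (norm_sub_smul_perturbed_le (A₀ := A 0) hη.le (hAl 0) (hsl _ _)
        (norm_jac_pattern_sub_le ha hd hx hε hnear fun r => (ih2 r).trans (hle k))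
        (norm_jac_secantPattern_sub_le ha hd hx hε hnear (fun r => (ih2 r).trans (hle k))
          fun r => (hnext r).trans (hle (k + 1)))
        hηl hηc hc.le hlε hlow (u k)).trans ?_
      rw [pow_succ', mul_assoc]
      exact mul_le_mul_of_nonneg_left ih1 hρ0
  have hnearby : ∀ k r, ‖w k r - w0 r‖ ≤ R := fun k r => ((hinv k).2 r).trans
    (mul_le_of_le_one_right hR0 (by linarith [pow_nonneg hρ0 k]))
  have hAε : ∀ k, ‖A k - A 0‖ ≤ ε := fun k =>
    norm_jac_pattern_sub_le ha hd hx hε hnear (hnearby k)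
  have hlin : ∀ k, ‖u k - u 0 - (A 0).adjoint (w k - w 0)‖ ≤ ε * ‖w k - w 0‖ := by
    intro k
    have h1 := resid_sub_resid a x y (w 0) (w k)
    simp only [hu]
    rw [h1, ← sub_apply, ← map_sub]
    refine (ContinuousLinearMap.le_opNorm _ _).trans
      (mul_le_mul_of_nonneg_right ?_ (norm_nonneg _))
    rw [LinearIsometryEquiv.norm_map]
    exact norm_jac_secantPattern_sub_le ha hd hx hε hnear (fun r => hnearby 0 r) (hnearby k)
  obtain ⟨ζ, hζ⟩ := exists_adjoint_apply_eq (A := A 0) (c := 7 / 8 * c) (by positivity) hlow (- u 0)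
  have hζ' : (w0 + A 0 ζ) - w0 = A 0 ζ := by abel
  have hwL : (A 0).adjoint ((w0 + A 0 ζ) - w0) = - u 0 := by rw [hζ', hζ]
  refine ⟨w0 + A 0 ζ, (isMinNormInterpolator_iff_eq hζ' hwL _).2 rfl,
    fun w hw => (isMinNormInterpolator_iff_eq hζ' hwL _).1 hw, fun k => ?_, ?_⟩
  · have h := norm_sub_le_of_inexact_descent (A₀ := A 0) (A := A) (w := w) (u := u) hη (hAl 0) hAε
      hAl hηl hηc hc hlow hw (fun k => (hinv k).1) hlin hζ' hwL k
    rwa [hl2] at h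
  · exact exists_tendsto_of_geometric_residual hη.le hAl hρ1 hw fun k => (hinv k).1

/-! ### Moments of the standard Gaussian and of random signs -/

section Gaussian

variable {E : Type*} [NormedAddCommGroup E] [InnerProductSpace ℝ E] [FiniteDimensional ℝ E]
  [MeasurableSpace E] [BorelSpace E]

lemma memLp_inner_stdGaussian (z : E) : MemLp (fun v : E => (inner ℝ z v : ℝ)) 2 (stdGaussian E) :=
  IsGaussian.memLp_dual (stdGaussian E) (innerSL ℝ z) 2 (by simp)

lemma integral_inner_sq_stdGaussian (z : E) :
    ∫ v, (inner ℝ z v : ℝ) ^ 2 ∂stdGaussian E = ‖z‖ ^ 2 := by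
  have h := variance_dual_stdGaussian (innerSL ℝ z)
  rw [variance_of_integral_eq_zero (by fun_prop) (integral_strongDual_stdGaussian _),
    innerSL_apply_norm] at h
  exact h

/-- Anti-concentration: the density of a standard Gaussian is at most `1 / 2`. -/
lemma stdGaussian_abs_inner_le (z : E) (hz : z ≠ 0) (R : ℝ) :
    stdGaussian E {v | |inner ℝ v z| ≤ R * ‖z‖} ≤ ENNReal.ofReal R := by
  have hz0 : 0 < ‖z‖ := norm_pos_iff.2 hz
  set e : E := ‖z‖⁻¹ • z with he
  have hnorm : ‖e‖ = 1 := by rw [he, norm_smul, norm_inv, norm_norm, inv_mul_cancel₀ hz0.ne']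
  have hset : {v : E | |inner ℝ v z| ≤ R * ‖z‖} = (innerSL ℝ e) ⁻¹' Set.Icc (-R) R := by
    ext v
    rw [Set.mem_ofPred_eq, Set.mem_preimage, innerSL_apply_apply, he, real_inner_smul_left,
      Set.mem_Icc, ← abs_le, abs_mul, abs_inv, abs_norm, real_inner_comm v z,
      inv_mul_le_iff₀ hz0, mul_comm R]
  have hlaw : (stdGaussian E).map (innerSL ℝ e) = gaussianReal 0 1 := by
    rw [IsGaussian.map_eq_gaussianReal, integral_strongDual_stdGaussian, variance_dual_stdGaussian,
      innerSL_apply_norm, hnorm]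
    simp
  rw [hset, ← Measure.map_apply (by fun_prop) measurableSet_Icc, hlaw,
    gaussianReal_apply 0 one_ne_zero]
  have hpdf : ∀ t : ℝ, gaussianPDF 0 1 t ≤ ENNReal.ofReal (1 / 2) := by
    intro t
    refine ENNReal.ofReal_le_ofReal ?_
    rw [gaussianPDFReal_def]
    have h2 : (2 : ℝ) ≤ √(2 * Real.pi * ((1 : NNReal) : ℝ)) := by
      refine Real.le_sqrt_of_sq_le ?_
      have := Real.pi_gt_three
      norm_num
      linarith
    have h3 : Real.exp (-(t - 0) ^ 2 / (2 * ((1 : NNReal) : ℝ))) ≤ 1 := by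
      refine Real.exp_le_one_iff.2 ?_
      have := sq_nonneg t
      norm_num
      linarith
    calc _ ≤ (2 : ℝ)⁻¹ * 1 := mul_le_mul (inv_anti₀ (by norm_num) h2) h3 (Real.exp_nonneg _)
          (by norm_num)
      _ = _ := by norm_num
  calc ∫⁻ t in Set.Icc (-R) R, gaussianPDF 0 1 t
      ≤ ∫⁻ _ in Set.Icc (-R) R, ENNReal.ofReal (1 / 2) := lintegral_mono fun t => hpdf t
    _ = ENNReal.ofReal R := by
      rw [setLIntegral_const, Real.volume_Icc, ← ENNReal.ofReal_mul (by norm_num)]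
      ring_nf

end Gaussian

lemma integral_signLaw (f : ℝ → ℝ) : ∫ a, f a ∂signLaw = (f 1 + f (-1)) / 2 := by
  have hi : ∀ b : ℝ, Integrable f ((2⁻¹ : ℝ≥0∞) • Measure.dirac b) := fun b =>
    (integrable_dirac (by simp)).smul_measure (by simp)
  rw [signLaw, integral_add_measure (hi _) (hi _), integral_smul_measure, integral_smul_measure,
    integral_dirac, integral_dirac]
  simp
  ring

lemma ae_signLaw : ∀ᵐ a ∂signLaw, a ^ 2 = 1 := by
  rw [signLaw, ae_add_measure_iff]
  constructor <;> refine Measure.ae_smul_measure ?_ _ <;>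
    simp [ae_dirac_eq]

lemma memLp_mul_signLaw (b : ℝ) : MemLp (fun a => a * b) 2 signLaw := by
  refine MemLp.of_bound (by fun_prop) |b| ?_
  filter_upwards [ae_signLaw] with a ha
  rw [Real.norm_eq_abs, abs_mul, ← Real.sqrt_sq_eq_abs a, ha, Real.sqrt_one, one_mul]

/-- Independent random signs are orthonormal. -/
lemma integral_sq_sum_sign (b : Fin m → ℝ) :
    ∫ a, (∑ r, a r * b r) ^ 2 ∂(Measure.pi fun _ : Fin m => signLaw) = ∑ r, b r ^ 2 := by
  have hint : ∀ r, Integrable (fun a : Fin m → ℝ => a r * b r)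
      (Measure.pi fun _ : Fin m => signLaw) := fun r =>
    ((memLp_mul_signLaw (b r)).comp_measurePreserving
      (measurePreserving_eval (fun _ : Fin m => signLaw) r)).integrable (by norm_num)
  have h0 : ∫ a, (∑ r, a r * b r) ∂(Measure.pi fun _ : Fin m => signLaw) = 0 := by
    rw [integral_finsetSum _ fun r _ => hint r]
    refine Finset.sum_eq_zero fun r _ => ?_
    rw [integral_comp_eval (μ := fun _ : Fin m => signLaw) (f := fun a => a * b r) (by fun_prop),
      integral_signLaw]
    ring
  have h := variance_sum_pi (μ := fun _ : Fin m => signLaw) (X := fun r a => a * b r)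
    fun r => memLp_mul_signLaw (b r)
  have hfun : (∑ r, fun a : Fin m → ℝ => a r * b r) = fun a => ∑ r, a r * b r := by
    ext a
    simp
  rw [hfun, variance_of_integral_eq_zero (Measurable.aemeasurable (by fun_prop)) h0] at h
  rw [h]
  refine Finset.sum_congr rfl fun r _ => ?_
  rw [variance_of_integral_eq_zero (by fun_prop) (by rw [integral_signLaw]; ring),
    integral_signLaw]
  ring

/-- The mean square error of an empirical mean of `m` independent samples of a bounded function. -/
lemma integral_sq_empirical_mean_sub_le {Ω : Type*} [MeasurableSpace Ω] (μ : Measure Ω)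
    [IsProbabilityMeasure μ] (hm : 0 < m) {g : Ω → ℝ} (hg : Measurable g) {B : ℝ}
    (hB : ∀ ω, |g ω| ≤ B) :
    ∫ w, ((∑ r, g (w r)) / m - ∫ ω, g ω ∂μ) ^ 2 ∂(Measure.pi fun _ : Fin m => μ) ≤ B ^ 2 / m := by
  have hm0 : (m : ℝ) ≠ 0 := by positivity
  have hmem : MemLp (fun ω => g ω / m) 2 μ := by
    refine MemLp.of_bound (by fun_prop) (B / m) (.of_forall fun ω => ?_)
    rw [Real.norm_eq_abs, abs_div, Nat.abs_cast]
    gcongr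
    exact hB ω
  have hint : ∀ r : Fin m, Integrable (fun w : Fin m → Ω => g (w r) / m)
      (Measure.pi fun _ : Fin m => μ) := fun r =>
    (hmem.comp_measurePreserving (measurePreserving_eval (fun _ : Fin m => μ) r)).integrable
      (by norm_num)
  have hmean : ∫ w, (∑ r, g (w r) / m) ∂(Measure.pi fun _ : Fin m => μ) = ∫ ω, g ω ∂μ := by
    rw [integral_finsetSum _ fun r _ => hint r]
    have : ∀ r : Fin m, ∫ w, g (w r) / m ∂(Measure.pi fun _ : Fin m => μ)
        = (∫ ω, g ω ∂μ) / m := fun r => by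
      rw [integral_comp_eval (μ := fun _ : Fin m => μ) (f := fun ω => g ω / m) (by fun_prop),
        integral_div]
    simp_rw [this]
    simp
    field_simp
  have h := variance_sum_pi (μ := fun _ : Fin m => μ) (X := fun _ ω => g ω / m) fun r => hmem
  have hfun : (∑ r : Fin m, fun w : Fin m → Ω => g (w r) / m) = fun w => ∑ r, g (w r) / m := by
    ext a
    simp
  rw [hfun, variance_eq_integral (Measurable.aemeasurable (by fun_prop)), hmean] at h
  simp_rw [Finset.sum_div]
  rw [h]
  have hvar : Var[fun ω => g ω / m; μ] ≤ (B / m) ^ 2 := by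
    refine (variance_le_expectation_sq (by fun_prop)).trans ?_
    have hle : ∀ ω, (g ω / m) ^ 2 ≤ (B / m) ^ 2 := fun ω => by
      rw [← sq_abs, abs_div, Nat.abs_cast]
      gcongr
      exact hB ω
    calc ∫ ω, ((fun ω => g ω / m) ^ 2) ω ∂μ ≤ ∫ _, (B / m) ^ 2 ∂μ := by
          refine integral_mono_of_nonneg (.of_forall fun ω => sq_nonneg _) (integrable_const _)
            (.of_forall hle)
      _ = (B / m) ^ 2 := by simp
  refine (Finset.sum_le_sum fun r _ => hvar).trans (le_of_eq ?_)
  simp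
  field_simp

/-! ### Expectations over the initialization -/

instance isProbabilityMeasure_initLaw : IsProbabilityMeasure (initLaw d m) := by
  unfold initLaw
  infer_instance

lemma measurePreserving_neuron (r : Fin m) :
    MeasurePreserving (fun p : Init d m => p.2 r) (initLaw d m) (stdGaussian (Neuron d)) :=
  (measurePreserving_eval (fun _ : Fin m => stdGaussian (Neuron d)) r).comp
    measurePreserving_snd

lemma ae_sign_sq : ∀ᵐ p ∂initLaw d m, ∀ r, p.1 r ^ 2 = 1 := by
  rw [ae_all_iff]
  intro r
  have h : MeasurePreserving (fun p : Init d m => p.1 r) (initLaw d m) signLaw :=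
    (measurePreserving_eval (fun _ : Fin m => signLaw) r).comp measurePreserving_fst
  exact h.quasiMeasurePreserving.ae ae_signLaw

@[fun_prop]
lemma measurable_relu : Measurable relu := measurable_id.max measurable_const

@[fun_prop]
lemma measurable_reluDeriv : Measurable reluDeriv :=
  Measurable.ite measurableSet_Ici measurable_const measurable_const

/-- The contribution of a single neuron to the Gram matrix of the gradients. -/
def pairKernel (x x' : Input d) (v : Neuron d) : ℝ :=
  reluDeriv (inner ℝ v (aug x)) * reluDeriv (inner ℝ v (aug x')) * inner ℝ (aug x) (aug x')

@[fun_prop]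
lemma measurable_pairKernel (x x' : Input d) : Measurable (pairKernel x x') := by
  unfold pairKernel
  fun_prop

lemma abs_pairKernel_le {x x' : Input d} (hd : 0 < d) (hx : ‖x‖ = √(d : ℝ))
    (hx' : ‖x'‖ = √(d : ℝ)) (v : Neuron d) : |pairKernel x x' v| ≤ 2 * d := by
  have h1 := reluDeriv_mem (inner ℝ v (aug x))
  have h2 := reluDeriv_mem (inner ℝ v (aug x'))
  have h3 : |(inner ℝ (aug x) (aug x') : ℝ)| ≤ 2 * d := by
    refine (abs_real_inner_le_norm _ _).trans ?_
    have := norm_aug_sq_le hd hx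
    have := norm_aug_sq_le hd hx'
    nlinarith [sq_nonneg (‖aug x‖ - ‖aug x'‖)]
  rw [pairKernel, abs_mul, abs_of_nonneg (mul_nonneg h1.1 h2.1)]
  calc _ ≤ (1 * 1) * (2 * (d : ℝ)) := by
        gcongr
        exacts [h2.1, h1.2, h2.2]
    _ = _ := by ring

lemma integrable_pairKernel {x x' : Input d} (hd : 0 < d) (hx : ‖x‖ = √(d : ℝ))
    (hx' : ‖x'‖ = √(d : ℝ)) : Integrable (pairKernel x x') (stdGaussian (Neuron d)) :=
  Integrable.of_bound (by fun_prop) (2 * d) (.of_forall fun v => abs_pairKernel_le hd hx hx' v)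

lemma inner_gradNet {a : Fin m → ℝ} (ha : ∀ r, a r ^ 2 = 1) (x x' : Input d) (w : Weights d m) :
    inner ℝ (gradNet a x w) (gradNet a x' w) = (∑ r, pairKernel x x' (w r)) / m := by
  rw [PiLp.inner_apply, Finset.sum_div]
  refine Finset.sum_congr rfl fun r _ => ?_
  simp only [gradNet, pairKernel]
  rw [real_inner_smul_left, real_inner_smul_right]
  have h : a r / √(m : ℝ) * (a r / √(m : ℝ)) = 1 / m := by
    rw [div_mul_div_comm, ← sq, ha r, Real.mul_self_sqrt (Nat.cast_nonneg m)]
  linear_combination (reluDeriv (inner ℝ (w r) (aug x)) * reluDeriv (inner ℝ (w r) (aug x')) *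
    inner ℝ (aug x) (aug x')) * h

lemma kernelMatrix_apply (hm : 0 < m) {x : Fin n → Input d} (hd : 0 < d)
    (hx : ∀ i, ‖x i‖ = √(d : ℝ)) (i j : Fin n) :
    kernelMatrix m x i j = ∫ v, pairKernel (x i) (x j) v ∂stdGaussian (Neuron d) := by
  have hm0 : (m : ℝ) ≠ 0 := by positivity
  have h1 : kernelMatrix m x i j
      = ∫ p : Init d m, (∑ r, pairKernel (x i) (x j) (p.2 r)) / m ∂initLaw d m := by
    refine integral_congr_ae ?_
    filter_upwards [ae_sign_sq] with p hp
    exact inner_gradNet hp _ _ _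
  have h2 : ∀ r, ∫ p : Init d m, pairKernel (x i) (x j) (p.2 r) ∂initLaw d m
      = ∫ v, pairKernel (x i) (x j) v ∂stdGaussian (Neuron d) := fun r => by
    rw [← (measurePreserving_neuron (d := d) r).map_eq,
      integral_map (measurePreserving_neuron r).measurable.aemeasurable (by fun_prop)]
  have h3 : ∀ r, Integrable (fun p : Init d m => pairKernel (x i) (x j) (p.2 r))
      (initLaw d m) := fun r => (measurePreserving_neuron r).integrable_comp_of_integrable
    (integrable_pairKernel hd (hx i) (hx j))
  rw [h1, integral_div, integral_finsetSum _ fun r _ => h3 r]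
  simp_rw [h2]
  simp
  field_simp

/-- The squared Frobenius distance between the Gram matrix of the gradients at the hidden weights
`w` and its expectation. -/
def gramError (x : Fin n → Input d) (w : Fin m → Neuron d) : ℝ :=
  ∑ i, ∑ j, ((∑ r, pairKernel (x i) (x j) (w r)) / m - kernelMatrix m x i j) ^ 2

@[fun_prop]
lemma measurable_gramError (x : Fin n → Input d) :
    Measurable (gramError x : (Fin m → Neuron d) → ℝ) := by
  unfold gramError
  fun_prop

lemma integrable_gramError (hm : 0 < m) {x : Fin n → Input d} (hd : 0 < d)
    (hx : ∀ i, ‖x i‖ = √(d : ℝ)) (i j : Fin n) :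
    Integrable (fun w : Fin m → Neuron d =>
      ((∑ r, pairKernel (x i) (x j) (w r)) / m - kernelMatrix m x i j) ^ 2)
      (Measure.pi fun _ : Fin m => stdGaussian (Neuron d)) := by
  refine Integrable.of_bound (Measurable.aestronglyMeasurable (by fun_prop))
    ((2 * d + |kernelMatrix m x i j|) ^ 2)
    (.of_forall fun w => ?_)
  rw [Real.norm_eq_abs, abs_pow]
  have h : |(∑ r, pairKernel (x i) (x j) (w r)) / m| ≤ 2 * d := by
    rw [abs_div, Nat.abs_cast, div_le_iff₀ (by positivity)]
    refine (Finset.abs_sum_le_sum_abs _ _).trans ((Finset.sum_le_sum fun r _ =>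
      abs_pairKernel_le hd (hx i) (hx j) (w r)).trans (le_of_eq ?_))
    simp
    ring
  gcongr
  exact (abs_sub _ _).trans (by gcongr)

lemma integral_gramError_le (hm : 0 < m) {x : Fin n → Input d} (hd : 0 < d)
    (hx : ∀ i, ‖x i‖ = √(d : ℝ)) :
    Integrable (fun p : Init d m => gramError x p.2) (initLaw d m) ∧
      ∫ p, gramError x p.2 ∂initLaw d m ≤ 4 * ((d : ℝ) * n) ^ 2 / m := by
  have hint : Integrable (gramError x) (Measure.pi fun _ : Fin m => stdGaussian (Neuron d)) :=
    integrable_finsetSum _ fun i _ => integrable_finsetSum _ fun j _ =>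
      integrable_gramError hm hd hx i j
  refine ⟨hint.comp_snd _, ?_⟩
  have h1 : ∫ p : Init d m, gramError x p.2 ∂initLaw d m
      = ∫ w, gramError x w ∂(Measure.pi fun _ : Fin m => stdGaussian (Neuron d)) := by
    rw [initLaw, integral_fun_snd]
    simp
  rw [h1]
  unfold gramError
  rw [integral_finsetSum _ fun i _ => integrable_finsetSum _ fun j _ =>
      integrable_gramError hm hd hx i j]
  have h2 : ∀ i, ∫ w, ∑ j, ((∑ r, pairKernel (x i) (x j) (w r)) / m - kernelMatrix m x i j) ^ 2
      ∂(Measure.pi fun _ : Fin m => stdGaussian (Neuron d)) ≤ n * ((2 * d) ^ 2 / m) := by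
    intro i
    rw [integral_finsetSum _ fun j _ => integrable_gramError hm hd hx i j]
    refine (Finset.sum_le_card_nsmul _ _ ((2 * (d : ℝ)) ^ 2 / m) fun j _ => ?_).trans (by simp)
    rw [kernelMatrix_apply hm hd hx]
    exact integral_sq_empirical_mean_sub_le _ hm (measurable_pairKernel _ _)
      (abs_pairKernel_le hd (hx i) (hx j))
  refine (Finset.sum_le_card_nsmul _ _ _ fun i _ => h2 i).trans (le_of_eq ?_)
  simp
  ring

lemma measurable_net (x : Input d) : Measurable fun p : Init d m => net p.1 x p.w0 := by
  unfold net Init.w0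
  fun_prop

/-- The signs make the initial output a sum of orthogonal terms, each of second moment at most
`‖x̃‖² / m`. -/
lemma integral_net_sq_le (hm : 0 < m) (x : Input d) :
    Integrable (fun p : Init d m => net p.1 x p.w0 ^ 2) (initLaw d m) ∧
      ∫ p : Init d m, net p.1 x p.w0 ^ 2 ∂initLaw d m ≤ ‖aug x‖ ^ 2 := by
  have hm0 : (0 : ℝ) < m := by positivity
  let b : Neuron d → ℝ := fun v => relu (inner ℝ v (aug x)) / √(m : ℝ)
  have hb_meas : Measurable b := by fun_prop
  have hb : ∀ v, b v ^ 2 ≤ (inner ℝ (aug x) v : ℝ) ^ 2 / m := by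
    intro v
    simp only [b]
    rw [div_pow, Real.sq_sqrt hm0.le, real_inner_comm v (aug x)]
    have : relu (inner ℝ v (aug x)) ^ 2 ≤ (inner ℝ v (aug x) : ℝ) ^ 2 := by
      rw [sq_le_sq]
      unfold relu
      rcases max_cases (inner ℝ v (aug x) : ℝ) 0 with h | h <;> rw [h.1]
      simp
    gcongr
  have hgauss : Integrable (fun v => (inner ℝ (aug x) v : ℝ) ^ 2 / m)
      (stdGaussian (Neuron d)) := (memLp_inner_stdGaussian (aug x)).integrable_sq.div_const _
  have hb_int : Integrable (fun v => b v ^ 2) (stdGaussian (Neuron d)) := by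
    refine hgauss.mono' (by fun_prop) (.of_forall fun v => ?_)
    rw [Real.norm_of_nonneg (sq_nonneg _)]
    exact hb v
  have hb_le : ∫ v, b v ^ 2 ∂stdGaussian (Neuron d) ≤ ‖aug x‖ ^ 2 / m := by
    refine (integral_mono hb_int hgauss hb).trans (le_of_eq ?_)
    rw [integral_div, integral_inner_sq_stdGaussian]
  have hnet : ∀ (a : Fin m → ℝ) (w : Fin m → Neuron d),
      net a x (Init.w0 (a, w)) = ∑ r, a r * b (w r) := fun a w => by
    rw [net]
    refine Finset.sum_congr rfl fun r _ => ?_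
    simp only [b, Init.w0]
    ring
  have hterm_int : ∀ r, Integrable (fun w : Fin m → Neuron d => b (w r) ^ 2)
      (Measure.pi fun _ : Fin m => stdGaussian (Neuron d)) := fun r =>
    (measurePreserving_eval (fun _ : Fin m => stdGaussian (Neuron d)) r
      ).integrable_comp_of_integrable hb_int
  have hint : Integrable (fun p : Init d m => net p.1 x p.w0 ^ 2) (initLaw d m) := by
    rw [initLaw, integrable_prod_iff' ((measurable_net x).pow_const 2).aestronglyMeasurable]
    constructor
    · refine .of_forall fun w => ?_
      simp only [hnet]
      have hmem : MemLp (fun a : Fin m → ℝ => ∑ r, a r * b (w r)) 2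
          (Measure.pi fun _ : Fin m => signLaw) :=
        memLp_finsetSum _ fun r _ => (memLp_mul_signLaw (b (w r))).comp_measurePreserving
          (measurePreserving_eval (fun _ : Fin m => signLaw) r)
      exact hmem.integrable_sq
    · refine (integrable_finsetSum Finset.univ fun r _ => hterm_int r).congr
        (.of_forall fun w => ?_)
      simp only [hnet, Real.norm_of_nonneg (sq_nonneg _)]
      exact (integral_sq_sum_sign _).symm
  refine ⟨hint, ?_⟩
  rw [initLaw, integral_prod_symm _ hint]
  simp only [hnet, integral_sq_sum_sign]
  rw [integral_finsetSum _ fun r _ => hterm_int r]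
  have h : ∀ r : Fin m, ∫ w : Fin m → Neuron d, b (w r) ^ 2
      ∂(Measure.pi fun _ : Fin m => stdGaussian (Neuron d)) ≤ ‖aug x‖ ^ 2 / m := fun r => by
    rw [integral_comp_eval (μ := fun _ : Fin m => stdGaussian (Neuron d))
      (f := fun v => b v ^ 2) (by fun_prop)]
    exact hb_le
  refine (Finset.sum_le_card_nsmul _ _ _ fun r _ => h r).trans (le_of_eq ?_)
  simp
  field_simp

lemma integral_sum_net_sq_le (hm : 0 < m) {x : Fin n → Input d} (hd : 0 < d)
    (hx : ∀ i, ‖x i‖ = √(d : ℝ)) :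
    Integrable (fun p : Init d m => ∑ i, net p.1 (x i) p.w0 ^ 2) (initLaw d m) ∧
      ∫ p : Init d m, ∑ i, net p.1 (x i) p.w0 ^ 2 ∂initLaw d m ≤ 2 * ((d : ℝ) * n) := by
  refine ⟨integrable_finsetSum _ fun i _ => (integral_net_sq_le hm (x i)).1, ?_⟩
  rw [integral_finsetSum _ fun i _ => (integral_net_sq_le hm (x i)).1]
  refine (Finset.sum_le_card_nsmul _ _ (2 * (d : ℝ)) fun i _ =>
    (integral_net_sq_le hm (x i)).2.trans (norm_aug_sq_le hd (hx i))).trans (le_of_eq ?_)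
  simp
  ring

lemma measurable_nearIndicator (R : ℝ) (x : Input d) :
    Measurable fun v : Neuron d => nearIndicator R v x := by
  unfold nearIndicator
  refine Measurable.ite ?_ measurable_const measurable_const
  exact measurableSet_le (by fun_prop) measurable_const

lemma integrable_nearIndicator (R : ℝ) (x : Input d) :
    Integrable (fun v => nearIndicator R v x) (stdGaussian (Neuron d)) := by
  refine Integrable.of_bound (measurable_nearIndicator R x).aestronglyMeasurable 1
    (.of_forall fun v => ?_)
  rw [Real.norm_of_nonneg (nearIndicator_nonneg _ _ _)]
  unfold nearIndicator
  split_ifs <;> simp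

lemma integral_nearIndicator_le {R : ℝ} (hR : 0 ≤ R) (x : Input d) :
    ∫ v, nearIndicator R v x ∂stdGaussian (Neuron d) ≤ R := by
  have h1 : (fun v : Neuron d => nearIndicator R v x)
      = Set.indicator {v | |inner ℝ v (aug x)| ≤ R * ‖aug x‖} 1 := by
    ext v
    simp [nearIndicator, Set.indicator_apply]
  have hmeas : MeasurableSet {v : Neuron d | |inner ℝ v (aug x)| ≤ R * ‖aug x‖} :=
    measurableSet_le (by fun_prop) measurable_const
  rw [h1, integral_indicator_one hmeas]
  exact ENNReal.toReal_le_of_le_ofReal hR (stdGaussian_abs_inner_le _ (aug_ne_zero x) R)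

lemma integral_sum_nearIndicator_le {R : ℝ} (hR : 0 ≤ R) (x : Fin n → Input d) :
    Integrable (fun p : Init d m => ∑ i, ∑ r, nearIndicator R (p.2 r) (x i)) (initLaw d m) ∧
      ∫ p : Init d m, ∑ i, ∑ r, nearIndicator R (p.2 r) (x i) ∂initLaw d m ≤ n * m * R := by
  have hint : ∀ i, ∀ r, Integrable (fun p : Init d m => nearIndicator R (p.2 r) (x i))
      (initLaw d m) := fun i r =>
    (measurePreserving_neuron r).integrable_comp_of_integrable (integrable_nearIndicator R (x i))
  have hint' : ∀ i, Integrable (fun p : Init d m => ∑ r, nearIndicator R (p.2 r) (x i))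
      (initLaw d m) := fun i => integrable_finsetSum _ fun r _ => hint i r
  refine ⟨integrable_finsetSum _ fun i _ => hint' i, ?_⟩
  rw [integral_finsetSum _ fun i _ => hint' i]
  have h : ∀ i, ∫ p : Init d m, ∑ r, nearIndicator R (p.2 r) (x i) ∂initLaw d m ≤ m * R := by
    intro i
    rw [integral_finsetSum _ fun r _ => hint i r]
    refine (Finset.sum_le_card_nsmul _ _ R fun r _ => ?_).trans (by simp)
    refine le_trans (le_of_eq ?_) (integral_nearIndicator_le hR (x i))
    rw [← (measurePreserving_neuron (d := d) r).map_eq,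
      integral_map (measurePreserving_neuron r).measurable.aemeasurable
        (measurable_nearIndicator R (x i)).aestronglyMeasurable]
  refine (Finset.sum_le_card_nsmul _ _ _ fun i _ => h i).trans (le_of_eq ?_)
  simp
  ring

/-! ### Positive definiteness of the kernel matrix -/

lemma dotProduct_mulVec_eq_sum (M : Matrix (Fin n) (Fin n) ℝ) (u : Fin n → ℝ) :
    star u ⬝ᵥ (M.mulVec u) = ∑ i, ∑ j, u i * u j * M i j := by
  simp only [dotProduct, Matrix.mulVec, Pi.star_apply, star_trivial, Finset.mul_sum]
  exact Finset.sum_congr rfl fun i _ => Finset.sum_congr rfl fun j _ => by ring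

lemma isHermitian_kernelMatrix (x : Fin n → Input d) : (kernelMatrix m x).IsHermitian := by
  ext i j
  simp only [kernelMatrix, Matrix.conjTranspose_apply, Matrix.of_apply, star_trivial]
  exact integral_congr_ae (.of_forall fun p => real_inner_comm _ _)

/-- The `i`-th row is the gradient of a single neuron with weights `v` on the data point `x_i`. -/
def neuronGrad (x : Fin n → Input d) (v : Neuron d) (i : Fin n) : Neuron d :=
  reluDeriv (inner ℝ v (aug (x i))) • aug (x i)

lemma norm_rowComb_neuronGrad_sq (x : Fin n → Input d) (v : Neuron d)
    (u : EuclideanSpace ℝ (Fin n)) : ‖rowComb (neuronGrad x v) u‖ ^ 2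
      = ∑ i, ∑ j, u i * u j * pairKernel (x i) (x j) v := by
  rw [norm_rowComb_apply_sq]
  refine Finset.sum_congr rfl fun i _ => Finset.sum_congr rfl fun j _ => ?_
  rw [neuronGrad, neuronGrad, real_inner_smul_left, real_inner_smul_right, pairKernel]
  ring

lemma integral_norm_rowComb_neuronGrad_sq (hm : 0 < m) {x : Fin n → Input d} (hd : 0 < d)
    (hx : ∀ i, ‖x i‖ = √(d : ℝ)) (u : EuclideanSpace ℝ (Fin n)) :
    Integrable (fun v => ‖rowComb (neuronGrad x v) u‖ ^ 2) (stdGaussian (Neuron d)) ∧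
    ∫ v, ‖rowComb (neuronGrad x v) u‖ ^ 2 ∂stdGaussian (Neuron d)
      = ∑ i, ∑ j, u i * u j * kernelMatrix m x i j := by
  have hint : ∀ i j, Integrable (fun v => u i * u j * pairKernel (x i) (x j) v)
      (stdGaussian (Neuron d)) := fun i j =>
    (integrable_pairKernel hd (hx i) (hx j)).const_mul _
  simp_rw [norm_rowComb_neuronGrad_sq]
  refine ⟨integrable_finsetSum _ fun i _ => integrable_finsetSum _ fun j _ => hint i j, ?_⟩
  rw [integral_finsetSum _ fun i _ => integrable_finsetSum _ fun j _ => hint i j]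
  refine Finset.sum_congr rfl fun i _ => ?_
  rw [integral_finsetSum _ fun j _ => hint i j]
  refine Finset.sum_congr rfl fun j _ => ?_
  rw [integral_const_mul, kernelMatrix_apply hm hd hx]

instance isOpenPosMeasure_stdGaussian_euclidean (ι : Type*) [Fintype ι] :
    (stdGaussian (EuclideanSpace ℝ ι)).IsOpenPosMeasure := by
  have : (gaussianReal 0 1).IsOpenPosMeasure :=
    (gaussianReal_absolutelyContinuous' 0 one_ne_zero).isOpenPosMeasure
  rw [← map_pi_eq_stdGaussian]
  exact (PiLp.continuous_toLp 2 _).isOpenPosMeasure_map (WithLp.toLp_surjective 2)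

lemma inner_lt_of_ne {x x' : Input d} (hx : ‖x‖ = √(d : ℝ)) (hx' : ‖x'‖ = √(d : ℝ))
    (h : x ≠ x') : (inner ℝ x x' : ℝ) < d := by
  have h1 : 0 < ‖x - x'‖ ^ 2 := pow_pos (norm_pos_iff.2 (sub_ne_zero.2 h)) 2
  rw [norm_sub_sq_real, hx, hx', Real.sq_sqrt (Nat.cast_nonneg d)] at h1
  linarith

/-- The neurons that are active on one chosen data point and on no other one form a nonempty set:
as the data points have the same norm and are distinct, the weights `(x_i, t - d)` with a small
`t > 0` are an example. -/
lemma exists_neuron_active_only_at {x : Fin n → Input d} (hx : ∀ i, ‖x i‖ = √(d : ℝ))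
    (hinj : Function.Injective x) (i : Fin n) :
    ∃ v : Neuron d, 0 < (inner ℝ v (aug (x i)) : ℝ) ∧
      ∀ j, j ≠ i → (inner ℝ v (aug (x j)) : ℝ) < 0 := by
  have hlt : ∀ j, j ≠ i → ∀ᶠ t : ℝ in 𝓝[>] 0, (inner ℝ (x j) (x i) : ℝ) + (t - d) < 0 := by
    intro j hj
    have h := inner_lt_of_ne (hx j) (hx i) (hinj.ne hj)
    have h' : ∀ᶠ t : ℝ in 𝓝 0, t < d - inner ℝ (x j) (x i) := gt_mem_nhds (by linarith)
    filter_upwards [h'.filter_mono nhdsWithin_le_nhds] with t ht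
    linarith
  have hall : ∀ᶠ t : ℝ in 𝓝[>] 0, ∀ j, j ≠ i → (inner ℝ (x j) (x i) : ℝ) + (t - d) < 0 := by
    rw [eventually_all]
    intro j
    by_cases hj : j = i
    · simp [hj]
    · simpa [hj] using hlt j hj
  obtain ⟨t, ht, ht0⟩ := (hall.and self_mem_nhdsWithin).exists
  let v : Neuron d := WithLp.toLp 2 (Fin.snoc (α := fun _ => ℝ) (fun k => x i k) (t - d))
  have hv : ∀ j, (inner ℝ v (aug (x j)) : ℝ) = inner ℝ (x j) (x i) + (t - d) := by
    intro j
    rw [PiLp.inner_apply, Fin.sum_univ_castSucc, PiLp.inner_apply]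
    simp [v, aug, mul_comm]
  refine ⟨v, ?_, fun j hj => ?_⟩
  · rw [hv, real_inner_self_eq_norm_sq, hx, Real.sq_sqrt (Nat.cast_nonneg d)]
    have : 0 < t := ht0
    linarith
  · rw [hv]
    exact ht j hj

lemma rowComb_neuronGrad_of_active_only_at {x : Fin n → Input d} {v : Neuron d} {i : Fin n}
    (hi : 0 < (inner ℝ v (aug (x i)) : ℝ)) (hj : ∀ j, j ≠ i → (inner ℝ v (aug (x j)) : ℝ) < 0)
    (u : EuclideanSpace ℝ (Fin n)) : rowComb (neuronGrad x v) u = u i • aug (x i) := by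
  rw [rowComb_apply, Finset.sum_eq_single i]
  · rw [neuronGrad, reluDeriv, if_pos hi.le, one_smul]
  · intro j _ h
    rw [neuronGrad, reluDeriv, if_neg (not_le.2 (hj j h)), zero_smul, smul_zero]
  · simp

/-- The kernel matrix is positive definite: its quadratic form is an integral of squares, and the
integrand is positive on the open set of neurons that are active on exactly one data point. -/
theorem posDef_kernelMatrix (hm : 0 < m) {x : Fin n → Input d} (hd : 0 < d)
    (hx : ∀ i, ‖x i‖ = √(d : ℝ)) (hinj : Function.Injective x) : (kernelMatrix m x).PosDef := by
  refine Matrix.PosDef.of_dotProduct_mulVec_pos (isHermitian_kernelMatrix x) fun u hu => ?_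
  obtain ⟨i, hi⟩ := Function.ne_iff.1 hu
  rw [dotProduct_mulVec_eq_sum]
  obtain ⟨hint, heq⟩ := integral_norm_rowComb_neuronGrad_sq hm hd hx (WithLp.toLp 2 u)
  simp only [] at heq
  rw [← heq, integral_pos_iff_support_of_nonneg (fun v => sq_nonneg _) hint]
  let s : Set (Neuron d) := {v | 0 < (inner ℝ v (aug (x i)) : ℝ) ∧
    ∀ j, j ≠ i → (inner ℝ v (aug (x j)) : ℝ) < 0}
  have hs_open : IsOpen s := by
    have : s = {v | 0 < (inner ℝ v (aug (x i)) : ℝ)} ∩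
        ⋂ j : Fin n, ⋂ _ : j ≠ i, {v | (inner ℝ v (aug (x j)) : ℝ) < 0} := by
      ext v
      simp [s]
    rw [this]
    refine (isOpen_lt continuous_const (by fun_prop)).inter (isOpen_iInter_of_finite fun j => ?_)
    exact isOpen_iInter_of_finite fun _ => isOpen_lt (by fun_prop) continuous_const
  refine (hs_open.measure_pos _ (exists_neuron_active_only_at hx hinj i)).trans_le
    (measure_mono fun v hv => ?_)
  rw [Function.mem_support, rowComb_neuronGrad_of_active_only_at hv.1 hv.2]
  have h1 : (u i • aug (x i)) ≠ 0 := smul_ne_zero hi (aug_ne_zero _)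
  exact pow_ne_zero 2 (norm_ne_zero_iff.2 h1)

/-! ### Good initializations -/

/-- A lower bound for the kernel matrix carries over, with a loss of an eighth, to the Gram matrix
of the gradients at an initialization where the two are close. -/
lemma le_norm_jac_apply_sq {p : Init d m} (hp : ∀ r, p.1 r ^ 2 = 1) {x : Fin n → Input d} {c : ℝ}
    (hc : 0 < c) (hH : (kernelMatrix m x - c • (1 : Matrix (Fin n) (Fin n) ℝ)).PosSemidef)
    (hgram : gramError x p.2 ≤ c ^ 2 / 64) (u : EuclideanSpace ℝ (Fin n)) :
    7 / 8 * c * ‖u‖ ^ 2 ≤ ‖(jac p.1 x fun i => pattern p.w0 (x i)) u‖ ^ 2 := by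
  have hu : ‖u‖ ^ 2 = ∑ i, u i ^ 2 := EuclideanSpace.real_norm_sq_eq u
  have h1 : c * ‖u‖ ^ 2 ≤ ∑ i, ∑ j, u i * u j * kernelMatrix m x i j := by
    have h := hH.dotProduct_mulVec_nonneg u
    rw [Matrix.sub_mulVec, dotProduct_sub, dotProduct_mulVec_eq_sum, Matrix.smul_mulVec,
      Matrix.one_mulVec, dotProduct_smul] at h
    have h' : star (u : Fin n → ℝ) ⬝ᵥ (u : Fin n → ℝ) = ‖u‖ ^ 2 := by
      rw [hu, dotProduct]
      exact Finset.sum_congr rfl fun i _ => by simp [sq]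
    rw [h', smul_eq_mul] at h
    linarith
  have h2 : ‖(jac p.1 x fun i => pattern p.w0 (x i)) u‖ ^ 2
      = ∑ i, ∑ j, u i * u j * ((∑ r, pairKernel (x i) (x j) (p.2 r)) / m) := by
    rw [jac, norm_rowComb_apply_sq]
    refine Finset.sum_congr rfl fun i _ => Finset.sum_congr rfl fun j _ => ?_
    rw [← gradNet_eq_slopeGrad, ← gradNet_eq_slopeGrad, inner_gradNet hp]
    rfl
  let D : Fin n × Fin n → ℝ := fun q =>
    (∑ r, pairKernel (x q.1) (x q.2) (p.2 r)) / m - kernelMatrix m x q.1 q.2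
  have h3 : ‖(jac p.1 x fun i => pattern p.w0 (x i)) u‖ ^ 2
      = ∑ i, ∑ j, u i * u j * kernelMatrix m x i j + ∑ q, (u q.1 * u q.2) * D q := by
    rw [h2, Fintype.sum_prod_type, ← Finset.sum_add_distrib]
    refine Finset.sum_congr rfl fun i _ => ?_
    rw [← Finset.sum_add_distrib]
    exact Finset.sum_congr rfl fun j _ => by simp only [D]; ring
  have h4 : (∑ q, (u q.1 * u q.2) * D q) ^ 2 ≤ (c / 8 * ‖u‖ ^ 2) ^ 2 := by
    refine (Finset.sum_mul_sq_le_sq_mul_sq _ _ _).trans ?_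
    have h5 : ∑ q : Fin n × Fin n, (u q.1 * u q.2) ^ 2 = (‖u‖ ^ 2) ^ 2 := by
      rw [hu, Fintype.sum_prod_type, sq (∑ i, u i ^ 2), Finset.sum_mul_sum]
      simp_rw [mul_pow]
    have h6 : ∑ q, D q ^ 2 = gramError x p.2 := by
      rw [Fintype.sum_prod_type]
      rfl
    rw [h5, h6]
    calc (‖u‖ ^ 2) ^ 2 * gramError x p.2 ≤ (‖u‖ ^ 2) ^ 2 * (c ^ 2 / 64) := by gcongr
      _ = _ := by ring
  have h7 := (abs_le.1 (abs_le_of_sq_le_sq h4 (by positivity))).1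
  rw [h3]
  linarith

lemma norm_resid_le {a : Fin m → ℝ} {x : Fin n → Input d} {y : Fin n → ℝ} {w : Weights d m}
    {Cy B U : ℝ} (hy : ∀ i, |y i| ≤ Cy) (hB : ∑ i, net a (x i) w ^ 2 ≤ B) (hU : 0 ≤ U)
    (h : 2 * B + 2 * n * Cy ^ 2 ≤ U ^ 2) : ‖resid a x y w‖ ≤ U := by
  refine le_of_sq_le_sq (le_trans ?_ h) hU
  rw [EuclideanSpace.real_norm_sq_eq]
  have h1 : ∀ i, (resid a x y w i) ^ 2 ≤ 2 * net a (x i) w ^ 2 + 2 * Cy ^ 2 := by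
    intro i
    have h2 : y i ^ 2 ≤ Cy ^ 2 := by
      rw [← sq_abs]
      exact pow_le_pow_left₀ (abs_nonneg _) (hy i) 2
    simp only [resid]
    nlinarith [sq_nonneg (net a (x i) w + y i)]
  refine (Finset.sum_le_sum fun i _ => h1 i).trans ?_
  rw [Finset.sum_add_distrib, ← Finset.mul_sum]
  simp only [Finset.sum_const, Finset.card_univ, Fintype.card_fin, nsmul_eq_mul]
  linarith

/-- With probability greater than `1 - δ` the three events that the descent needs hold together,
by Markov's inequality for a weighted sum of the three quantities. -/
lemma exists_good_init (hd : 0 < d) (hn : 0 < n) (hm : 0 < m) {x : Fin n → Input d}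
    (hx : ∀ i, ‖x i‖ = √(d : ℝ)) {c δ R : ℝ} (hc : 0 < c) (hδ : 0 < δ) (hδ1 : δ < 1) (hR : 0 < R)
    (hmc : 1536 * ((d : ℝ) * n) ^ 2 ≤ m * c ^ 2 * δ) :
    ∃ G : Set (Init d m), MeasurableSet G ∧ ENNReal.ofReal (1 - δ) < initLaw d m G ∧
      ∀ p ∈ G, (∀ r, p.1 r ^ 2 = 1) ∧ gramError x p.2 ≤ c ^ 2 / 64 ∧
        ∑ i, net p.1 (x i) p.w0 ^ 2 ≤ 12 * ((d : ℝ) * n) / δ ∧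
        ∑ i, ∑ r, nearIndicator R (p.2 r) (x i) ≤ 6 * (n * m * R) / δ := by
  have hd0 : (0 : ℝ) < d := by positivity
  have hn0 : (0 : ℝ) < n := by positivity
  have hm0 : (0 : ℝ) < m := by positivity
  obtain ⟨i1, e1⟩ := integral_gramError_le (m := m) hm hd hx
  obtain ⟨i2, e2⟩ := integral_sum_net_sq_le (m := m) hm hd hx
  obtain ⟨i3, e3⟩ := integral_sum_nearIndicator_le (m := m) hR.le x
  let Φ : Init d m → ℝ := fun p => 64 / c ^ 2 * gramError x p.2
    + δ / (12 * (d * n)) * (∑ i, net p.1 (x i) p.w0 ^ 2)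
    + δ / (6 * (n * m * R)) * (∑ i, ∑ r, nearIndicator R (p.2 r) (x i))
  have hΦint : Integrable Φ (initLaw d m) :=
    ((i1.const_mul _).add (i2.const_mul _)).add (i3.const_mul _)
  have g1 : ∀ p : Init d m, 0 ≤ 64 / c ^ 2 * gramError x p.2 := fun p =>
    mul_nonneg (by positivity)
      (Finset.sum_nonneg fun i _ => Finset.sum_nonneg fun j _ => sq_nonneg _)
  have g2 : ∀ p : Init d m, 0 ≤ δ / (12 * (d * n)) * (∑ i, net p.1 (x i) p.w0 ^ 2) := fun p =>
    mul_nonneg (by positivity) (Finset.sum_nonneg fun i _ => sq_nonneg _)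
  have g3 : ∀ p : Init d m,
      0 ≤ δ / (6 * (n * m * R)) * (∑ i, ∑ r, nearIndicator R (p.2 r) (x i)) := fun p =>
    mul_nonneg (by positivity)
      (Finset.sum_nonneg fun i _ => Finset.sum_nonneg fun r _ => nearIndicator_nonneg _ _ _)
  have hΦ0 : ∀ p, 0 ≤ Φ p := fun p => add_nonneg (add_nonneg (g1 p) (g2 p)) (g3 p)
  have hΦmeas : Measurable Φ := by
    have m1 : Measurable fun p : Init d m => gramError x p.2 := by fun_prop
    have m2 : Measurable fun p : Init d m => ∑ i, net p.1 (x i) p.w0 ^ 2 :=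
      Finset.measurable_sum _ fun i _ => (measurable_net (x i)).pow_const 2
    have m3 : Measurable fun p : Init d m => ∑ i, ∑ r, nearIndicator R (p.2 r) (x i) :=
      Finset.measurable_sum _ fun i _ => Finset.measurable_sum _ fun r _ =>
        (measurable_nearIndicator R (x i)).comp (measurePreserving_neuron r).measurable
    exact ((m1.const_mul _).add (m2.const_mul _)).add (m3.const_mul _)
  have hΦ : ∫ p, Φ p ∂initLaw d m ≤ δ / 2 := by
    have e1' : 64 / c ^ 2 * ∫ p, gramError x p.2 ∂initLaw d m ≤ δ / 6 := by
      calc _ ≤ 64 / c ^ 2 * (4 * ((d : ℝ) * n) ^ 2 / m) := by gcongr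
        _ ≤ δ / 6 := by
          rw [div_mul_div_comm, div_le_div_iff₀ (by positivity) (by norm_num)]
          linarith
    have e2' : δ / (12 * (d * n)) * ∫ p : Init d m, ∑ i, net p.1 (x i) p.w0 ^ 2 ∂initLaw d m
        ≤ δ / 6 := by
      calc _ ≤ δ / (12 * (d * n)) * (2 * ((d : ℝ) * n)) := by gcongr
        _ = δ / 6 := by field_simp; norm_num
    have e3' : δ / (6 * (n * m * R)) *
        ∫ p : Init d m, ∑ i, ∑ r, nearIndicator R (p.2 r) (x i) ∂initLaw d m ≤ δ / 6 := by
      calc _ ≤ δ / (6 * (n * m * R)) * (n * m * R) := by gcongr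
        _ = δ / 6 := by field_simp
    have hsum : ∫ p, Φ p ∂initLaw d m = 64 / c ^ 2 * ∫ p, gramError x p.2 ∂initLaw d m
        + δ / (12 * (d * n)) * ∫ p : Init d m, ∑ i, net p.1 (x i) p.w0 ^ 2 ∂initLaw d m
        + δ / (6 * (n * m * R)) *
          ∫ p : Init d m, ∑ i, ∑ r, nearIndicator R (p.2 r) (x i) ∂initLaw d m := by
      have a1 := integral_add ((i1.const_mul (64 / c ^ 2)).add
        (i2.const_mul (δ / (12 * (d * n))))) (i3.const_mul (δ / (6 * (n * m * R))))
      have a2 := integral_add (i1.const_mul (64 / c ^ 2)) (i2.const_mul (δ / (12 * (d * n))))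
      simp only [Pi.add_apply] at a1 a2
      rw [integral_const_mul, integral_const_mul] at a2
      rw [integral_const_mul, a2] at a1
      exact a1
    rw [hsum]
    linarith
  have hmarkov := mul_meas_ge_le_integral_of_nonneg (.of_forall hΦ0) hΦint 1
  rw [one_mul] at hmarkov
  have hmeasΦ : MeasurableSet {p | 1 ≤ Φ p} := measurableSet_le measurable_const hΦmeas
  have hgood : 1 - δ < (initLaw d m).real {p | 1 ≤ Φ p}ᶜ := by
    rw [probReal_compl_eq_one_sub hmeasΦ]
    linarith
  have hsign : MeasurableSet {p : Init d m | ∀ r, p.1 r ^ 2 = 1} := by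
    have : {p : Init d m | ∀ r, p.1 r ^ 2 = 1} = ⋂ r, {p : Init d m | p.1 r ^ 2 = 1} := by
      ext p
      simp
    rw [this]
    exact MeasurableSet.iInter fun r => measurableSet_eq_fun (by fun_prop) measurable_const
  refine ⟨{p | 1 ≤ Φ p}ᶜ ∩ {p | ∀ r, p.1 r ^ 2 = 1}, hmeasΦ.compl.inter hsign, ?_, ?_⟩
  · have h : initLaw d m ({p | 1 ≤ Φ p}ᶜ ∩ {p | ∀ r, p.1 r ^ 2 = 1})
        = initLaw d m {p | 1 ≤ Φ p}ᶜ := by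
      refine measure_congr ?_
      filter_upwards [ae_sign_sq] with p hp
      refine propext ⟨fun h => h.1, fun h => ⟨h, hp⟩⟩
    rw [h]
    exact (ENNReal.ofReal_lt_iff_lt_toReal (by linarith) (measure_ne_top _ _)).2 hgood
  · rintro p ⟨hp1, hp2⟩
    have hlt : Φ p < 1 := not_le.1 hp1
    simp only [Φ] at hlt
    have k1 := g1 p
    have k2 := g2 p
    have k3 := g3 p
    have b1 : 64 / c ^ 2 * gramError x p.2 ≤ 1 := by linarith
    have b2 : δ / (12 * (d * n)) * (∑ i, net p.1 (x i) p.w0 ^ 2) ≤ 1 := by linarith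
    have b3 : δ / (6 * (n * m * R)) * (∑ i, ∑ r, nearIndicator R (p.2 r) (x i)) ≤ 1 := by linarith
    refine ⟨hp2, ?_, ?_, ?_⟩
    · rw [div_mul_eq_mul_div, div_le_one (by positivity)] at b1
      linarith
    · rw [div_mul_eq_mul_div, div_le_one (by positivity)] at b2
      rw [le_div_iff₀ hδ]
      linarith
    · rw [div_mul_eq_mul_div, div_le_one (by positivity)] at b3
      rw [le_div_iff₀ hδ]
      linarith

/-! ### The choice of the constants -/

/-- With `U`, `R`, `ε` the bounds on the initial residual, on the movement of a single neuron and
on the change of the Jacobian, a width of the order `N¹⁰ C⁶ / (c¹⁰ δ⁶)` makes the perturbation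
small against `c` and bounds the final error. Everything is reduced to the fourth power of `ε`,
in which no roots are left. -/
lemma width_bounds {N Cy c δ m : ℝ} (hN : 1 ≤ N) (hCy : 1 ≤ Cy) (hc : 0 < c) (hcN : c ≤ 2 * N)
    (hδ : 0 < δ) (hδ1 : δ < 1) (hm : 0 < m)
    (hwidth : 10 ^ 11 * (N ^ 10 * Cy ^ 6 / (c ^ 10 * δ ^ 6)) ≤ m) {U R ε : ℝ}
    (hU : 0 < U) (hU2 : U ^ 2 = 36 * N * Cy ^ 2 / δ)
    (hR : R = 2 * √(2 * N) * U / (c * √m)) (hε : 0 ≤ ε) (hε2 : ε ^ 2 = 12 * N * R / δ) :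
    1536 * N ^ 2 ≤ m * c ^ 2 * δ ∧ 8 * √(2 * N) * ε ≤ c ∧
      2 * ε * U / c + 8 * (2 * N) * ε * U / c ^ 2 ≤
        100 * ((N * Cy) ^ (3 / 2 : ℝ) / (c ^ (3 / 2 : ℝ) * δ ^ (3 / 2 : ℝ) * m ^ (1 / 8 : ℝ))) := by
  have hN0 : 0 < N := by linarith
  have hCy0 : 0 < Cy := by linarith
  have hwidth' : 10 ^ 11 * (N ^ 10 * Cy ^ 6) ≤ m * (c ^ 10 * δ ^ 6) := by
    rwa [mul_div_assoc', div_le_iff₀ (by positivity)] at hwidth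
  have hδpow : ∀ k : ℕ, δ ^ k ≤ 1 := fun k => pow_le_one₀ hδ.le hδ1.le
  have hR2 : R ^ 2 = 288 * N ^ 2 * Cy ^ 2 / (δ * c ^ 2 * m) := by
    rw [hR, div_pow, mul_pow, mul_pow, mul_pow, Real.sq_sqrt (by positivity),
      Real.sq_sqrt hm.le, hU2]
    field_simp
    ring
  have hε4 : ε ^ 4 = 41472 * N ^ 4 * Cy ^ 2 / (δ ^ 3 * c ^ 2 * m) := by
    rw [show ε ^ 4 = (ε ^ 2) ^ 2 by ring, hε2, div_pow, mul_pow, hR2]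
    field_simp
    ring
  have hCy1 : ∀ k : ℕ, 1 ≤ Cy ^ k := fun k => one_le_pow₀ hCy
  have h1 : 1536 * N ^ 2 ≤ m * c ^ 2 * δ := by
    have h2 : N ^ 8 * (10 ^ 11 * N ^ 2) ≤ N ^ 8 * (256 * (m * c ^ 2 * δ)) := by
      calc N ^ 8 * (10 ^ 11 * N ^ 2) = 10 ^ 11 * (N ^ 10 * 1) := by ring
        _ ≤ 10 ^ 11 * (N ^ 10 * Cy ^ 6) := by gcongr; exact hCy1 6
        _ ≤ m * (c ^ 10 * δ ^ 6) := hwidth'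
        _ = m * c ^ 2 * δ * (c ^ 8 * δ ^ 5) := by ring
        _ ≤ m * c ^ 2 * δ * ((2 * N) ^ 8 * 1) := by gcongr; exact hδpow 5
        _ = _ := by ring
    have h3 := le_of_mul_le_mul_left h2 (by positivity)
    nlinarith [sq_nonneg N]
  have h2 : 8 * √(2 * N) * ε ≤ c := by
    refine le_of_pow_le_pow_left₀ (n := 4) (by norm_num) hc.le ?_
    have hs : √(2 * N) ^ 4 = 4 * N ^ 2 := by
      rw [show √(2 * N) ^ 4 = (√(2 * N) ^ 2) ^ 2 by ring, Real.sq_sqrt (by positivity)]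
      ring
    rw [mul_pow, mul_pow, hs, hε4, mul_div_assoc', div_le_iff₀ (by positivity)]
    have h4 : N ^ 4 * (10 ^ 11 * (N ^ 6 * Cy ^ 2)) ≤ N ^ 4 * (16 * (m * c ^ 6 * δ ^ 3)) := by
      calc N ^ 4 * (10 ^ 11 * (N ^ 6 * Cy ^ 2)) = 10 ^ 11 * (N ^ 10 * (Cy ^ 2 * 1)) := by ring
        _ ≤ 10 ^ 11 * (N ^ 10 * (Cy ^ 2 * Cy ^ 4)) := by gcongr; exact hCy1 4
        _ = 10 ^ 11 * (N ^ 10 * Cy ^ 6) := by ring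
        _ ≤ m * (c ^ 10 * δ ^ 6) := hwidth'
        _ = m * c ^ 6 * δ ^ 3 * (c ^ 4 * δ ^ 3) := by ring
        _ ≤ m * c ^ 6 * δ ^ 3 * ((2 * N) ^ 4 * 1) := by gcongr; exact hδpow 3
        _ = _ := by ring
    have h5 := le_of_mul_le_mul_left h4 (by positivity)
    have h6 : 0 ≤ N ^ 6 * Cy ^ 2 := by positivity
    linarith
  refine ⟨h1, h2, ?_⟩
  -- The first error term is dominated by the second, as `c ≤ 2 N`.
  have h3 : 2 * ε * U / c + 8 * (2 * N) * ε * U / c ^ 2 ≤ 20 * N * ε * U / c ^ 2 := by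
    rw [← mul_div_mul_right (2 * ε * U) c hc.ne', ← sq c, ← add_div]
    gcongr
    have : ε * U * c ≤ ε * U * (2 * N) := by gcongr
    linarith
  refine h3.trans (le_of_pow_le_pow_left₀ (n := 8) (by norm_num) (by positivity) ?_)
  have hr : ∀ t : ℝ, 0 ≤ t → (t ^ (3 / 2 : ℝ)) ^ 8 = t ^ 12 := by
    intro t ht
    rw [← Real.rpow_natCast, ← Real.rpow_mul ht, ← Real.rpow_natCast]
    norm_num
  have hr' : (m ^ (1 / 8 : ℝ)) ^ 8 = m := by
    rw [← Real.rpow_natCast, ← Real.rpow_mul hm.le]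
    norm_num
  have hL : (20 * N * ε * U / c ^ 2) ^ 8
      = 20 ^ 8 * N ^ 8 * (ε ^ 4) ^ 2 * (U ^ 2) ^ 4 / c ^ 16 := by
    field_simp
  have hT : (100 * ((N * Cy) ^ (3 / 2 : ℝ) /
      (c ^ (3 / 2 : ℝ) * δ ^ (3 / 2 : ℝ) * m ^ (1 / 8 : ℝ)))) ^ 8
      = 100 ^ 8 * (N ^ 12 * Cy ^ 12 / (c ^ 12 * δ ^ 12 * m)) := by
    rw [mul_pow, div_pow, mul_pow (_ * _) (m ^ _), mul_pow (c ^ _), hr _ (by positivity),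
      hr _ hc.le, hr _ hδ.le, hr', mul_pow]
  have h4 : 10 ^ 11 * N ^ 8 ≤ 4 * (m * c ^ 8) := by
    have h5 : N ^ 2 * (10 ^ 11 * N ^ 8) ≤ N ^ 2 * (4 * (m * c ^ 8)) := by
      calc N ^ 2 * (10 ^ 11 * N ^ 8) = 10 ^ 11 * (N ^ 10 * 1) := by ring
        _ ≤ 10 ^ 11 * (N ^ 10 * Cy ^ 6) := by gcongr; exact hCy1 6
        _ ≤ m * (c ^ 10 * δ ^ 6) := hwidth'
        _ = m * c ^ 8 * (c ^ 2 * δ ^ 6) := by ring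
        _ ≤ m * c ^ 8 * ((2 * N) ^ 2 * 1) := by gcongr; exact hδpow 6
        _ = _ := by ring
    exact le_of_mul_le_mul_left h5 (by positivity)
  have hratio : (20 : ℝ) ^ 8 * 41472 ^ 2 * 36 ^ 4 * (N ^ 8 * δ ^ 2) ≤ 100 ^ 8 * (m * c ^ 8) := by
    have h5 : N ^ 8 * δ ^ 2 ≤ N ^ 8 * 1 := by gcongr; exact hδpow 2
    have h6 : 0 ≤ m * c ^ 8 := by positivity
    norm_num at h4 h5 ⊢
    linarith
  rw [hL, hT, hε4, hU2]
  calc 20 ^ 8 * N ^ 8 * (41472 * N ^ 4 * Cy ^ 2 / (δ ^ 3 * c ^ 2 * m)) ^ 2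
        * (36 * N * Cy ^ 2 / δ) ^ 4 / c ^ 16
      = 20 ^ 8 * 41472 ^ 2 * 36 ^ 4 * (N ^ 8 * δ ^ 2) *
          (N ^ 12 * Cy ^ 12 / (c ^ 20 * δ ^ 12 * m ^ 2)) := by
        field_simp
    _ ≤ 100 ^ 8 * (m * c ^ 8) * (N ^ 12 * Cy ^ 12 / (c ^ 20 * δ ^ 12 * m ^ 2)) :=
        mul_le_mul_of_nonneg_right hratio (by positivity)
    _ = _ := by
        field_simp

lemma le_of_kernelMatrix_sub_posSemidef {d n m : ℕ} (hd : 0 < d) (hn : 0 < n) (hm : 0 < m)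
    {x : Fin n → Input d} (hx : ∀ i, ‖x i‖ = √(d : ℝ)) {c : ℝ}
    (hH : (kernelMatrix m x - c • (1 : Matrix (Fin n) (Fin n) ℝ)).PosSemidef) :
    c ≤ 2 * ((d : ℝ) * n) := by
  have h := hH.diag_nonneg (i := ⟨0, hn⟩)
  simp only [Matrix.sub_apply, Matrix.smul_apply, Matrix.one_apply_eq, smul_eq_mul, mul_one] at h
  have h2 : kernelMatrix m x ⟨0, hn⟩ ⟨0, hn⟩ ≤ 2 * d := by
    rw [kernelMatrix_apply hm hd hx]
    calc _ ≤ ∫ _, (2 * (d : ℝ)) ∂stdGaussian (Neuron d) :=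
          integral_mono (integrable_pairKernel hd (hx _) (hx _)) (integrable_const _)
            fun v => (abs_le.1 (abs_pairKernel_le hd (hx _) (hx _) v)).2
      _ = 2 * d := by simp
  have h3 : (1 : ℝ) ≤ n := by exact_mod_cast hn
  have h4 : (d : ℝ) * 1 ≤ d * n := by gcongr
  linarith

end ReLUNet

end

theorem mainTheorem1 :
    ∃ K₁ K₂ K₃ : ℝ, 0 < K₁ ∧ 0 < K₂ ∧ 0 < K₃ ∧
      ∀ (d n m : ℕ), 0 < d → 0 < n → 0 < m →
      ∀ (x : Fin n → ReLUNet.Input d) (y : Fin n → ℝ) (Cy : ℝ),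
        1 ≤ Cy → (∀ i, |y i| ≤ Cy) → (∀ i, ‖x i‖ = √(d : ℝ)) →
        (∀ i j, i ≠ j → LinearIndependent ℝ ![x i, x j]) →
        (ReLUNet.kernelMatrix m x).PosDef ∧
        ∀ (c δ η : ℝ), 0 < c →
          (ReLUNet.kernelMatrix m x - c • (1 : Matrix (Fin n) (Fin n) ℝ)).PosSemidef →
          0 < δ → δ < 1 →
          K₁ * (((d : ℝ) * n) ^ 10 * Cy ^ 6 / (c ^ 10 * δ ^ 6)) ≤ (m : ℝ) →
          0 < η → η ≤ K₂ * (c / ((d : ℝ) * n) ^ 2) →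
          ∃ G : Set (ReLUNet.Init d m), MeasurableSet G ∧
            ENNReal.ofReal (1 - δ) < ReLUNet.initLaw d m G ∧
            ∀ p ∈ G,
              ∃ wL : ReLUNet.Weights d m,
                ReLUNet.IsMinNormInterpolator p.1 p.w0 x y wL ∧
                (∀ w, ReLUNet.IsMinNormInterpolator p.1 p.w0 x y w → w = wL) ∧
                (∀ k : ℕ, ‖ReLUNet.gd p.1 x y η p.w0 k - wL‖ ≤
                  (1 - c * η / 2) ^ ((k : ℝ) / 2) * ‖p.w0 - wL‖ +
                    K₃ * (((d : ℝ) * n * Cy) ^ (3 / 2 : ℝ) /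
                      (c ^ (3 / 2 : ℝ) * δ ^ (3 / 2 : ℝ) * (m : ℝ) ^ (1 / 8 : ℝ)))) ∧
                ∃ wStar : ReLUNet.Weights d m,
                  Tendsto (fun k => ReLUNet.gd p.1 x y η p.w0 k) atTop (𝓝 wStar) := by
  refine ⟨10 ^ 11, 1 / 16, 100, by norm_num, by norm_num, by norm_num,
    fun d n m hd hn hm x y Cy hCy hy hx hli => ?_⟩
  have hinj : Function.Injective x := by
    intro i j hij
    by_contra hne
    have h := (hli i j hne).injective.ne (show (0 : Fin 2) ≠ 1 by decide)
    simp [hij] at h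
  refine ⟨ReLUNet.posDef_kernelMatrix hm hd hx hinj,
    fun c δ η hc hH hδ hδ1 hwidth hη hηK => ?_⟩
  have hd1 : (1 : ℝ) ≤ d := by exact_mod_cast hd
  have hn1 : (1 : ℝ) ≤ n := by exact_mod_cast hn
  have hm0 : (0 : ℝ) < m := by exact_mod_cast hm
  have hcN := ReLUNet.le_of_kernelMatrix_sub_posSemidef hd hn hm hx hH
  set N : ℝ := (d : ℝ) * n with hNdef
  have hN : 1 ≤ N := one_le_mul_of_one_le_of_one_le hd1 hn1
  have hnN : (n : ℝ) ≤ N := le_mul_of_one_le_left (by linarith) hd1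
  have hCy0 : 0 < Cy := by linarith
  set U : ℝ := √(36 * N * Cy ^ 2 / δ) with hUdef
  have hUpos : 0 < U := Real.sqrt_pos.2 (by positivity)
  have hU2 : U ^ 2 = 36 * N * Cy ^ 2 / δ := Real.sq_sqrt (by positivity)
  set R : ℝ := 2 * √(2 * N) * U / (c * √(m : ℝ)) with hRdef
  have hRpos : 0 < R := by positivity
  set ε : ℝ := √(12 * N * R / δ) with hεdef
  have hε0 : 0 ≤ ε := Real.sqrt_nonneg _
  have hε2 : ε ^ 2 = 12 * N * R / δ := Real.sq_sqrt (by positivity)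
  obtain ⟨hgram, hlε, herr⟩ := ReLUNet.width_bounds hN hCy hc hcN hδ hδ1 hm0 hwidth hUpos hU2
    hRdef hε0 hε2
  have hηN : η * N ≤ 1 / 8 := by
    calc η * N ≤ 1 / 16 * (c / N ^ 2) * N := by gcongr
      _ = 1 / 16 * (c / N) := by field_simp
      _ ≤ 1 / 16 * 2 := by
        gcongr
        rwa [div_le_iff₀ (by linarith)]
      _ = 1 / 8 := by norm_num
  have hηl : η * (2 * N) ≤ 1 / 4 := by linarith
  have hηc : η * c ≤ 1 := by
    have : η * c ≤ η * (2 * N) := by gcongr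
    linarith
  obtain ⟨G, hGmeas, hG, hgood⟩ :=
    ReLUNet.exists_good_init hd hn hm hx (c := c) (δ := δ) (R := R) hc hδ hδ1 hRpos hgram
  refine ⟨G, hGmeas, hG, fun p hp => ?_⟩
  obtain ⟨hsign, hpgram, hpnet, hpnear⟩ := hgood p hp
  have hpU : ‖ReLUNet.resid p.1 x y p.w0‖ ≤ U := by
    refine ReLUNet.norm_resid_le hy hpnet hUpos.le ?_
    rw [hU2, ← mul_div_assoc, div_add' _ _ _ hδ.ne']
    gcongr
    have h1 : 1 ≤ Cy ^ 2 := one_le_pow₀ hCy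
    have h2 : N * 1 ≤ N * Cy ^ 2 := by gcongr
    have h3 : (n : ℝ) * Cy ^ 2 * δ ≤ N * Cy ^ 2 * 1 := by gcongr
    linarith
  have hpnear' : 2 * (d : ℝ) / m * ∑ i, ∑ r, ReLUNet.nearIndicator R (p.w0 r) (x i) ≤ ε ^ 2 := by
    calc _ ≤ 2 * (d : ℝ) / m * (6 * (n * m * R) / δ) := by gcongr; exact hpnear
      _ = ε ^ 2 := by
        rw [hε2, hNdef]
        field_simp
        norm_num
  obtain ⟨wL, hwL, huniq, hbound, hconv⟩ := ReLUNet.gd_of_good_init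
    (fun r => (sq_le_one_iff_abs_le_one _).1 (hsign r).le) hd hm hx hη hc hε0 hηl hηc hlε
    (ReLUNet.le_norm_jac_apply_sq hsign hc hH hpgram) hpU hRdef hpnear'
  refine ⟨wL, hwL, huniq, fun k => (hbound k).trans ?_, hconv⟩
  have hρ : 0 < 1 - c * η / 2 := by linarith
  have hpow : (1 - c * η / 2) ^ k ≤ (1 - c * η / 2) ^ ((k : ℝ) / 2) := by
    rw [← Real.rpow_natCast]
    refine Real.rpow_le_rpow_of_exponent_ge hρ ?_ ?_
    · have : 0 < c * η := by positivity
      linarith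
    · have : (0 : ℝ) ≤ k := Nat.cast_nonneg k
      linarith
  gcongr
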